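/- **Setting.** Let $K$ be a finite simplicial complex, and let homology be singular homology with $\mathbb Z/2$-coefficients. A filtration function is a function $f$ on the simplices of $K$ with $f(s)\le f(t)$ whenever $s\subseteq t$. If $a_0<\dots<a_n$ are its values, put $K_i=\{s: f(s)\le a_i\}$, and let the intermediate complex $\mathrm{IC}_i(f)$ be the closure of $K_i\setminus K_{i-1}$ (where $K_{-1}=\emptyset$), i.e. the set of all faces of the simplices with $f(s)=a_i$. A list of steps $S=(S_0,\dots,S_N)$, each of which either includes or contracts a subcomplex, defines a sequence of spaces: let $X_t$ be the union of the subcomplexes included in steps $0,\dots,t$ and $A_t$ the union of those contracted in steps $0,\dots,t$, and let $$Y_t=|X_t|/|A_t|\qquad (Y_t=|X_t| \text{ if } A_t=\emptyset),$$ with the maps $Y_t\to Y_{t+1}$ induced by inclusion. (Thus every contraction also takes in the point $*$ that represents everything contracted before.) We consider the following constructions: - *forward*: include $K_0,\dots,K_n$; - *contraction*: include $K$, then contract any sequence of subcomplexes of $K$ such that the last space is a point; - *backward*: include $K$, then contract $\mathrm{IC}_n(f),\dots,\mathrm{IC}_0(f)$; - *forward–backward (FB)*: include $K_0,\dots,K_n$,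 then contract $\mathrm{IC}_n(f),\dots,\mathrm{IC}_0(f)$; - *$(\sigma,\tau)$-FB*, for permutations $\sigma,\tau$ of $\{0,\dots,n\}$: include $\mathrm{IC}_{\sigma(0)}(f),\dots,\mathrm{IC}_{\sigma(n)}(f)$, then contract $\mathrm{IC}_{\tau(0)}(f),\dots,\mathrm{IC}_{\tau(n)}(f)$; - *$(f,g)$-FB*, for two filtration functions $f,g$: include the complexes of the filtration induced by $f$, then contract $\mathrm{IC}_0(g),\mathrm{IC}_1(g),\dots$ in this order; - *hourglass*: any sequence of steps that include or contract unions of complexes $\mathrm{IC}_i(f)$, in which each $\mathrm{IC}_i(f)$ is included before it is contracted. The $k$-th persistence diagram of a sequence of spaces is the multiset of pairs (birth, death) of the intervals in an interval decomposition of the sequence of its $k$-th homology groups (death $\infty$ if the feature survives to the end). The *simplicial quotient method* replaces $Y_\bullet$ by a filtration $Z_\bullet$: a disjoint vertex $v_+$ is present from the start, inclusions are carried out as before, and whenever a simplex $\sigma$ is to be contracted one adds the simplex $[v_+,\sigma]$ instead. So the simplices of $Z_t$ are those of $X_t$, the vertex $v_+$, and $[v_+,\sigma]$ for $\sigma\in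 A_t$. **Proposition.** For each of these constructions: 1. For every $K$, every sequence of the construction on $K$, and every $k>0$, the sequences $Y_\bullet$ and $Z_\bullet$ have the same $k$-th persistence diagram. 2. For every $K$ and every such sequence, the $0$-th persistence diagram of $Y_\bullet$ is computed by tracking one vertex representative per component, as follows. A vertex included in step $t$ is born at $t$ and represents itself. Then the new edges are processed one at a time, in any order; each joins the components of its endpoints. In a contraction step, the vertices of the contracted subcomplex are processed one at a time, in any order; the component of each is joined with the component that contains $*$ (the first vertex ever contracted initiates $*$). Whenever two different components are joined in step $t$, the representative that was born later is killed, ties being broken arbitrarily; the other one represents the joined component, and the pair (birth, $t$) is recorded unless birth $=t$. At the end, the pair (birth, $\infty$) is recorded for each remaining representative. 3. In degree $0$ the method may fail: there are a complex $K$ and a sequence of the construction on $K$ such that the $0$-th persistence diagrams of $Y_\bullet$ and $Z_\bullet$ differ. -/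

import Mathlib

universe u

namespace ContractionPersistence

open CategoryTheory AlgebraicTopology

/-! ### Simplicial complexes and their realizations -/

/-- A simplicial complex with vertices among the elements of `V` (not every element of `V` has to
be a vertex). All subcomplexes of a complex on `V` are again of this type, ordered by inclusion. -/
abbrev SComplex (V : Type u) : Type u := PreAbstractSimplicialComplex V

/-- The geometric realization: points in barycentric coordinates whose support is contained in a
face. It carries the subspace topology of `V → ℝ`, the usual one as `V` will be finite. -/
def realization {V : Type u} (K : SComplex V) : Set (V → ℝ) :=
  {x | ∃ s ∈ K, (∀ v, 0 ≤ x v) ∧ (∀ v, v ∉ s → x v = 0) ∧ ∑ v ∈ s, x v = 1}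

theorem realization_mono {V : Type u} {K L : SComplex V} (h : K ≤ L) :
    realization K ⊆ realization L := by
  rintro x ⟨s, hs, hx⟩
  exact ⟨s, h hs, hx⟩

/-- The equivalence relation on `|X|` that identifies all the points of `|A|` with each other. -/
def contractSetoid {V : Type u} (X A : SComplex V) : Setoid (realization X) where
  r x y := x = y ∨ ((x : V → ℝ) ∈ realization A ∧ (y : V → ℝ) ∈ realization A)
  iseqv :=
    { refl := fun x => Or.inl rfl
      symm := by
        rintro x y (h | ⟨h, h'⟩)
        · exact Or.inl h.symm
        · exact Or.inr ⟨h', h⟩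
      trans := by
        rintro x y z (rfl | ⟨h, h'⟩) (rfl | ⟨h₁, h₁'⟩)
        · exact Or.inl rfl
        · exact Or.inr ⟨h₁, h₁'⟩
        · exact Or.inr ⟨h, h'⟩
        · exact Or.inr ⟨h, h₁'⟩ }

/-- The quotient space `|X| / |A|` (equal to `|X|` when `A` is empty). -/
abbrev ContractedSpace {V : Type u} (X A : SComplex V) : Type u := Quotient (contractSetoid X A)

/-- The map `|X| / |A| → |X'| / |A'|` induced by the inclusion `|X| ⊆ |X'|`, when `A ≤ A'`. It is
an inclusion if `A = A'` and a quotient map if `X = X'`. -/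
def contractedMap {V : Type u} {X X' A A' : SComplex V} (hX : X ≤ X') (hA : A ≤ A') :
    C(ContractedSpace X A, ContractedSpace X' A') where
  toFun := Quotient.map' (Set.inclusion (realization_mono hX)) (by
    rintro x y (rfl | ⟨h, h'⟩)
    · exact Or.inl rfl
    · exact Or.inr ⟨realization_mono hA h, realization_mono hA h'⟩)
  continuous_toFun := Continuous.quotient_map' (continuous_inclusion (realization_mono hX)) _

/-- The sequence of spaces `|X 0| / |A 0| → |X 1| / |A 1| → ...`. -/
def contractedSequence {V : Type u} (X A : ℕ →o SComplex V) : ℕ ⥤ TopCat.{u} where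
  obj t := TopCat.of (ContractedSpace (X t) (A t))
  map h := TopCat.ofHom (contractedMap (X.monotone (leOfHom h)) (A.monotone (leOfHom h)))
  map_id t := by
    ext x
    induction x using Quotient.inductionOn
    rfl
  map_comp f g := by
    ext x
    induction x using Quotient.inductionOn
    rfl

/-- The sequence of inclusions `|Z 0| → |Z 1| → ...` of a filtration by complexes. -/
def inclusionSequence {V : Type u} (Z : ℕ →o SComplex V) : ℕ ⥤ TopCat.{u} where
  obj t := TopCat.of (realization (Z t))
  map h := TopCat.ofHom
    ⟨Set.inclusion (realization_mono (Z.monotone (leOfHom h))), continuous_inclusion _⟩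
  map_id t := by
    ext x
    rfl
  map_comp f g := by
    ext x
    rfl

/-! ### Persistent homology and persistence diagrams -/

/-- Singular homology in degree `k` with coefficients in `ℤ/2`. -/
noncomputable def homologyMod2 (k : ℕ) : TopCat.{u} ⥤ ModuleCat.{u} (ZMod 2) :=
  (singularHomologyFunctor (ModuleCat.{u} (ZMod 2)) k).obj
    (ModuleCat.of (ZMod 2) (ULift.{u} (ZMod 2)))

/-- The `k`-th persistent homology of a sequence of spaces. -/
noncomputable abbrev persistentHomology (k : ℕ) (Y : ℕ ⥤ TopCat.{u}) :
    ℕ ⥤ ModuleCat.{u} (ZMod 2) := Y ⋙ homologyMod2 k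

/-- `D` is a persistence diagram of `M`: the module `M` has an interval decomposition whose
intervals, recorded as pairs (birth, death), form the multiset `D`. The interval with index `i`
is spanned by the non-zero vectors `e t i`, `b i ≤ t < d i`; a feature that never dies has
death `⊤`. -/
def IsPersistenceDiagram (M : ℕ ⥤ ModuleCat.{u} (ZMod 2)) (D : Multiset (ℕ × ℕ∞)) : Prop :=
  ∃ (n : ℕ) (b : Fin n → ℕ) (d : Fin n → ℕ∞) (e : (t : ℕ) → Fin n → M.obj t),
    (∀ i, (b i : ℕ∞) < d i) ∧
    D = (Finset.univ : Finset (Fin n)).val.map (fun i => (b i, d i)) ∧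
    (∀ t : ℕ,
      LinearIndependent (ZMod 2) (fun i : {i // b i ≤ t ∧ (t : ℕ∞) < d i} => e t i) ∧
      Submodule.span (ZMod 2)
        (Set.range fun i : {i // b i ≤ t ∧ (t : ℕ∞) < d i} => e t i) = ⊤) ∧
    (∀ (t : ℕ) (i : Fin n), b i ≤ t → (t : ℕ∞) < d i →
      (((t + 1 : ℕ) : ℕ∞) < d i →
        (M.map (homOfLE (Nat.le_succ t))).hom (e t i) = e (t + 1) i) ∧
      (((t + 1 : ℕ) : ℕ∞) = d i → (M.map (homOfLE (Nat.le_succ t))).hom (e t i) = 0))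

/-! ### Sequences of inclusions and contractions -/

/-- A step of a construction: include the subcomplex `L`, or contract the subcomplex `L`. -/
inductive Step (V : Type u) : Type u
  | spawn (L : SComplex V)
  | contract (L : SComplex V)

/-- What a step includes. -/
def Step.spawnPart {V : Type u} : Step V → SComplex V
  | .spawn L => L
  | .contract _ => ⊥

/-- What a step contracts. -/
def Step.contractPart {V : Type u} : Step V → SComplex V
  | .spawn _ => ⊥
  | .contract L => L

/-- The union of everything included in the steps `0, ..., t`. -/
def spawned {V : Type u} (S : List (Step V)) : ℕ →o SComplex V where
  toFun t := ⨆ s ∈ S.take (t + 1), s.spawnPart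
  monotone' _ _ h :=
    biSup_mono fun _ hs => List.take_subset_take_left S (Nat.succ_le_succ h) hs

/-- The union of everything contracted in the steps `0, ..., t`. -/
def contracted {V : Type u} (S : List (Step V)) : ℕ →o SComplex V where
  toFun t := ⨆ s ∈ S.take (t + 1), s.contractPart
  monotone' _ _ h :=
    biSup_mono fun _ hs => List.take_subset_take_left S (Nat.succ_le_succ h) hs

/-- The sequence of spaces given by a list of steps; the space with index `t` is the one reached
after the steps `0, ..., t`. A contraction contracts the new subcomplex together with the point
that represents everything contracted before. After the last step the sequence is continued by
identity maps, so that a feature that survives all the steps has death `⊤`. -/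
def quotientSequence {V : Type u} (S : List (Step V)) : ℕ ⥤ TopCat.{u} :=
  contractedSequence (spawned S) (contracted S)

/-- The complex `X` with a disjoint vertex `v₊` (the element `none`) and with a simplex
`[v₊, σ]` for every simplex `σ` of `A` (in use, `A` is a subcomplex of `X`). -/
def coneOff {V : Type u} (X A : SComplex V) : SComplex (Option V) where
  faces := {T | (none ∉ T ∧ Finset.eraseNone T ∈ X ⊔ A) ∨
    (none ∈ T ∧ (Finset.eraseNone T = ∅ ∨ Finset.eraseNone T ∈ A))}
  isRelLowerSet_faces := by
    rintro T hT
    have hne : T.Nonempty := by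
      rcases hT with ⟨_, h⟩ | ⟨h, _⟩
      · obtain ⟨v, hv⟩ := ((X ⊔ A).isRelLowerSet_faces h).1
        exact ⟨some v, Finset.mem_eraseNone.1 hv⟩
      · exact ⟨none, h⟩
    refine ⟨hne, fun U hUT hU => ?_⟩
    have hsub : Finset.eraseNone U ⊆ Finset.eraseNone T := Finset.eraseNone.monotone hUT
    have hUne : none ∉ U → (Finset.eraseNone U).Nonempty := by
      intro h
      obtain ⟨x, hx⟩ := hU
      cases x with
      | none => exact absurd hx h
      | some v => exact ⟨v, Finset.mem_eraseNone.2 hx⟩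
    rcases hT with ⟨h, h'⟩ | ⟨h, h'⟩
    · have hn : none ∉ U := fun hn => h (hUT hn)
      exact Or.inl ⟨hn, ((X ⊔ A).isRelLowerSet_faces h').2 hsub (hUne hn)⟩
    · by_cases hn : none ∈ U
      · refine Or.inr ⟨hn, ?_⟩
        by_cases hE : Finset.eraseNone U = ∅
        · exact Or.inl hE
        · refine Or.inr ?_
          rcases h' with h' | h'
          · exact absurd (Finset.subset_empty.1 (h' ▸ hsub)) hE
          · exact (A.isRelLowerSet_faces h').2 hsub (Finset.nonempty_iff_ne_empty.2 hE)
      · refine Or.inl ⟨hn, ?_⟩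
        rcases h' with h' | h'
        · exact absurd (Finset.subset_empty.1 (h' ▸ hsub)) (hUne hn).ne_empty
        · exact Or.inr ((A.isRelLowerSet_faces h').2 hsub (hUne hn))

theorem coneOff_mono {V : Type u} {X X' A A' : SComplex V} (hX : X ≤ X') (hA : A ≤ A') :
    coneOff X A ≤ coneOff X' A' := by
  rintro T (⟨h, h'⟩ | ⟨h, h'⟩)
  · exact Or.inl ⟨h, sup_le_sup hX hA h'⟩
  · exact Or.inr ⟨h, h'.imp_right fun h'' => hA h''⟩

/-- The filtration of the simplicial quotient method: `v₊` is there from the start, an inclusion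
of `L` adds the simplices of `L`, and a contraction of `L` adds `[v₊, σ]` for each simplex `σ`
of `L` instead. -/
def coneFiltration {V : Type u} (S : List (Step V)) : ℕ →o SComplex (Option V) where
  toFun t := coneOff (spawned S t) (contracted S t)
  monotone' _ _ h := coneOff_mono ((spawned S).monotone h) ((contracted S).monotone h)

/-- The sequence of spaces of the simplicial quotient method. -/
def coneSequence {V : Type u} (S : List (Step V)) : ℕ ⥤ TopCat.{u} :=
  inclusionSequence (coneFiltration S)

/-! ### Filtration functions and intermediate complexes -/

/-- `f` is a filtration function on `K` (its values outside `K` play no role). -/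
def IsFiltrationFunction {V : Type u} (K : SComplex V) (f : Finset V → ℝ) : Prop :=
  ∀ s ∈ K, ∀ t ∈ K, s ⊆ t → f s ≤ f t

/-- The finitely many values of `f` on the simplices of `K`. -/
noncomputable def levels {V : Type u} [Finite V] (K : SComplex V) (f : Finset V → ℝ) : Finset ℝ :=
  (Set.toFinite (f '' K.faces)).toFinset

/-- The number of non-empty complexes in the filtration of `K` induced by `f`. -/
noncomputable def numLevels {V : Type u} [Finite V] (K : SComplex V) (f : Finset V → ℝ) : ℕ :=
  (levels K f).card

/-- The values of `f` in increasing order. -/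
noncomputable def level {V : Type u} [Finite V] (K : SComplex V) (f : Finset V → ℝ)
    (i : Fin (numLevels K f)) : ℝ :=
  (levels K f).orderEmbOfFin rfl i

/-- The complex `K_i` of the filtration `∅ = K_{-1} ⊂ K_0 ⊂ ... ⊂ K_n = K` induced by `f`, where
`n + 1 = numLevels K f`. -/
noncomputable def sublevel {V : Type u} [Finite V] (K : SComplex V) (f : Finset V → ℝ)
    (hf : IsFiltrationFunction K f) (i : Fin (numLevels K f)) : SComplex V where
  faces := {s | s ∈ K ∧ f s ≤ level K f i}
  isRelLowerSet_faces := by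
    rintro s ⟨hs, hfs⟩
    refine ⟨(K.isRelLowerSet_faces hs).1, fun t hts ht => ?_⟩
    have htK : t ∈ K := (K.isRelLowerSet_faces hs).2 hts ht
    exact ⟨htK, (hf t htK s hs hts).trans hfs⟩

/-- The intermediate complex `IC_i`: the closure (all faces) of the set of the simplices
in `K_i` but not in `K_{i-1}`, which are those with `f s` equal to the `i`-th value. -/
noncomputable def intermediate {V : Type u} [Finite V] (K : SComplex V) (f : Finset V → ℝ)
    (i : Fin (numLevels K f)) : SComplex V where
  faces := {t | t.Nonempty ∧ ∃ s ∈ K, f s = level K f i ∧ t ⊆ s}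
  isRelLowerSet_faces := by
    rintro t ⟨ht, s, hs, hfs, hts⟩
    exact ⟨ht, fun r hrt hr => ⟨hr, s, hs, hfs, fun _ hx => hts (hrt hx)⟩⟩

/-! ### The constructions -/

/-- The forward steps `K_0 ⊂ ... ⊂ K_n = K`. -/
noncomputable def filtrationSteps {V : Type u} [Finite V] (K : SComplex V) (f : Finset V → ℝ)
    (hf : IsFiltrationFunction K f) : List (Step V) :=
  List.ofFn fun i => Step.spawn (sublevel K f hf i)

/-- Including the intermediate complexes in the order `σ`. -/
noncomputable def spawnSteps {V : Type u} [Finite V] (K : SComplex V) (f : Finset V → ℝ)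
    (σ : Equiv.Perm (Fin (numLevels K f))) : List (Step V) :=
  List.ofFn fun i => Step.spawn (intermediate K f (σ i))

/-- Contracting the intermediate complexes in the order `τ`. -/
noncomputable def contractSteps {V : Type u} [Finite V] (K : SComplex V) (f : Finset V → ℝ)
    (τ : Equiv.Perm (Fin (numLevels K f))) : List (Step V) :=
  List.ofFn fun i => Step.contract (intermediate K f (τ i))

/-- The hourglass sequences of `(K, f)`: every step includes or contracts a union of intermediate
complexes, and each of these is included before it is contracted. -/
def IsHourglass {V : Type u} [Finite V] (K : SComplex V) (f : Finset V → ℝ)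
    (S : List (Step V)) : Prop :=
  ∃ moves : List (Bool × Finset (Fin (numLevels K f))),
    S = moves.map (fun p => if p.1 then Step.spawn (⨆ i ∈ p.2, intermediate K f i)
      else Step.contract (⨆ i ∈ p.2, intermediate K f i)) ∧
    ∀ (q : ℕ) (I : Finset (Fin (numLevels K f))), moves[q]? = some (false, I) →
      ∀ i ∈ I, ∃ p < q, ∃ J, moves[p]? = some (true, J) ∧ i ∈ J

/-- The persistence constructions. -/
inductive Method : Type
  | forward
  | contraction
  | backward
  | forwardBackward
  | permutationForwardBackward
  | twoFunctionForwardBackward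
  | hourglass

/-- `m.IsSequence K S`: the list of steps `S` arises from the complex `K` by the construction
`m`, for some choice of the data of `m`. -/
def Method.IsSequence {V : Type u} [Finite V] (K : SComplex V) (S : List (Step V)) :
    Method → Prop
  | .forward => ∃ (f : Finset V → ℝ) (hf : IsFiltrationFunction K f), S = filtrationSteps K f hf
  | .contraction => ∃ Ls : List (SComplex V), (∀ L ∈ Ls, L ≤ K) ∧
      S = Step.spawn K :: Ls.map Step.contract ∧
      Nonempty (Unique ((quotientSequence S).obj Ls.length))
  | .backward => ∃ f : Finset V → ℝ, IsFiltrationFunction K f ∧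
      S = Step.spawn K :: contractSteps K f Fin.revPerm
  | .forwardBackward => ∃ (f : Finset V → ℝ) (hf : IsFiltrationFunction K f),
      S = filtrationSteps K f hf ++ contractSteps K f Fin.revPerm
  | .permutationForwardBackward => ∃ (f : Finset V → ℝ) (σ τ : Equiv.Perm (Fin (numLevels K f))),
      IsFiltrationFunction K f ∧ S = spawnSteps K f σ ++ contractSteps K f τ
  | .twoFunctionForwardBackward => ∃ (f g : Finset V → ℝ) (hf : IsFiltrationFunction K f),
      IsFiltrationFunction K g ∧
      S = filtrationSteps K f hf ++ contractSteps K g (Equiv.refl _)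
  | .hourglass => ∃ f : Finset V → ℝ, IsFiltrationFunction K f ∧ IsHourglass K f S

/-! ### Tracking one vertex representative per component -/

/-- The state of the tracking procedure. -/
structure Tracker (V : Type u) : Type u where
  /-- the representative of the component of a vertex -/
  rep : V → V
  /-- the time at which a vertex was spawned -/
  birth : V → ℕ
  /-- a vertex of the contracted part, as soon as something has been contracted -/
  star : Option V
  /-- the recorded pairs of the representatives that were killed -/
  dead : Multiset (ℕ × ℕ∞)

/-- The initial state (the values of `rep` and `birth` are set when a vertex is spawned). -/
def Tracker.init (V : Type u) : Tracker V := ⟨id, fun _ => 0, none, 0⟩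

open scoped Classical in
/-- At time `i`, kill the representative `l` in favour of `w`, which now also represents the
component of `l`. A trivial pair, with equal birth and death, is discarded. -/
noncomputable def Tracker.kill {V : Type u} (i : ℕ) (w l : V) (T : Tracker V) : Tracker V :=
  { T with
    rep := fun x => if T.rep x = l then w else T.rep x
    dead := if T.birth l < i then (T.birth l, (i : ℕ∞)) ::ₘ T.dead else T.dead }

open scoped Classical in
/-- At time `i`, the components of `u` and `v` are joined: if their representatives differ, the
one that was born later is killed. The rule `tie` decides between representatives of the
same age. -/
noncomputable def Tracker.merge {V : Type u} (tie : V → V → Bool) (i : ℕ) (u v : V)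
    (T : Tracker V) : Tracker V :=
  if T.rep u = T.rep v then T
  else if T.birth (T.rep u) < T.birth (T.rep v) ∨
      (T.birth (T.rep u) = T.birth (T.rep v) ∧ tie (T.rep u) (T.rep v) = true) then
    T.kill i (T.rep u) (T.rep v)
  else T.kill i (T.rep v) (T.rep u)

open scoped Classical in
/-- The inclusion of `L` into `X` at time `i`: spawn the new vertices, each its own
representative, and then the new edges, taken in the order of the list `es`. -/
noncomputable def Tracker.spawn {V : Type u} (tie : V → V → Bool) (es : List (V × V)) (i : ℕ)
    (X L : SComplex V) (T : Tracker V) : Tracker V :=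
  (es.filter fun e => decide (({e.1, e.2} : Finset V) ∈ L ∧ ({e.1, e.2} : Finset V) ∉ X)).foldl
    (fun T' e => T'.merge tie i e.1 e.2)
    { T with
      rep := fun v => if ({v} : Finset V) ∈ L ∧ ({v} : Finset V) ∉ X then v else T.rep v
      birth := fun v => if ({v} : Finset V) ∈ L ∧ ({v} : Finset V) ∉ X then i else T.birth v }

/-- At time `i`, the vertex `v` becomes part of the contracted point. -/
noncomputable def Tracker.contractVertex {V : Type u} (tie : V → V → Bool) (i : ℕ) (v : V)
    (T : Tracker V) : Tracker V :=
  match T.star with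
  | none => { T with star := some v }
  | some s => T.merge tie i s v

open scoped Classical in
/-- The contraction of `L` at time `i`: the vertices of `L` are taken in the order of the
list `vs`. -/
noncomputable def Tracker.contract {V : Type u} (tie : V → V → Bool) (vs : List V) (i : ℕ)
    (L : SComplex V) (T : Tracker V) : Tracker V :=
  (vs.filter fun v => decide (({v} : Finset V) ∈ L)).foldl
    (fun T' v => T'.contractVertex tie i v) T

/-- The run of the procedure through a list of steps, of which the first takes place at time `i`
when the complex `X` has been included so far. -/
noncomputable def Tracker.run {V : Type u} (tie : V → V → Bool) (vs : List V)
    (es : List (V × V)) : ℕ → SComplex V → List (Step V) → Tracker V → Tracker V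
  | _, _, [], T => T
  | i, X, .spawn L :: S, T =>
      Tracker.run tie vs es (i + 1) (X ⊔ L) S (T.spawn tie es i X L)
  | i, X, .contract L :: S, T =>
      Tracker.run tie vs es (i + 1) X S (T.contract tie vs i L)

/-- The pairs found by the procedure: those of the killed representatives, and `(birth, ⊤)` for
every vertex that still represents its component at the end. -/
noncomputable def trackedPairs {V : Type u} [Finite V] (tie : V → V → Bool) (vs : List V)
    (es : List (V × V)) (S : List (Step V)) : Multiset (ℕ × ℕ∞) :=
  let T := Tracker.run tie vs es 0 ⊥ S (Tracker.init V)
  T.dead + (Set.toFinite {v : V | {v} ∈ spawned S S.length ∧ T.rep v = v}).toFinset.val.map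
    (fun v => (T.birth v, (⊤ : ℕ∞)))

end ContractionPersistence

open ContractionPersistence

/-! All the constructions share one property: at every time t the contracted part A is a subcomplex
of the included part X (`Method.IsSequence.contracted_le_spawned`). The two positive claims hold for
every list of steps with this property.

Positive degrees. The complex Z is X with a cone CA over A attached, or X with a disjoint vertex if
A is empty. It is compared with |X|/|A| by the zigzag |Z| → |Z|/|CA| ← |X|/|A|, which is natural in
t. The left arrow is an isomorphism on homology because |Z| can be deformed so that the cone moves
inside itself to the apex; the deformation is written in barycentric coordinates
(`isIso_homologyMod2_map_collapseCone`). The right arrow is a homeomorphism if A is non-empty.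
Otherwise it misses only the apex, an isolated point, which does not contribute to homology in
positive degrees (`isIso_homologyMod2_map_toCollapse`). Hence the two persistence modules are
isomorphic.

Degree zero. Here homology has a basis indexed by path components, and the path components of
|X|/|A| are the vertices of X modulo the edges of X and the identification of all vertices of A
(`linked_of_joined`, `exists_basis_contractedClass`). A vertex v killed at time d in favour of an
heir w carries the feature [v] - [w], which becomes zero at time d; a vertex that is never killed
carries [v]. At each time the features of the living vertices are obtained from the basis of their
classes by a triangular change (`basis_feature`), and the structure maps send features to features.
This is an interval decomposition (`isPersistenceDiagram_of_elder_rule`). It remains to see that the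
tracker produces such deaths and heirs; the invariants are `Tracks` within a step and
`TrackedBefore` between steps.

Failure in degree zero. As long as nothing is contracted, the vertex v₊ is an extra component. Over
a single vertex the two modules therefore differ in dimension at time 0. -/

namespace ContractionPersistence
open CategoryTheory AlgebraicTopology

/-! ### Homology in degree zero -/

/-- The coefficients `ℤ/2` as an object of the category of modules. -/
noncomputable abbrev coefficients : ModuleCat.{u} (ZMod 2) :=
  ModuleCat.of (ZMod 2) (ULift.{u} (ZMod 2))

/-- The summands of a coproduct of copies of `ℤ/2` form a basis. -/
theorem exists_basis_sigma (I : Type u) :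
    ∃ b : Module.Basis I (ZMod 2) (∐ fun _ : I => coefficients.{u} : ModuleCat.{u} (ZMod 2)),
      ∀ i, b i = (Limits.Sigma.ι (fun _ : I => coefficients.{u}) i).hom ⟨1⟩ := by
  classical
  let e := (ModuleCat.coprodIsoDirectSum (fun _ : I => coefficients.{u})).toLinearEquiv
  let b₀ : Module.Basis I (ZMod 2) (DirectSum I fun _ => ULift.{u} (ZMod 2)) :=
    ⟨(DFinsupp.mapRange.linearEquiv fun _ => ULift.moduleEquiv).trans
      (finsuppLequivDFinsupp (ZMod 2)).symm⟩
  refine ⟨b₀.map e.symm, fun i => ?_⟩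
  have h := ModuleCat.ι_coprodIsoDirectSum_hom (fun _ : I => coefficients.{u}) i
  have hb : b₀ i = DirectSum.lof (ZMod 2) I (fun _ => ULift.{u} (ZMod 2)) i ⟨1⟩ := by
    apply b₀.repr.injective
    rw [b₀.repr_self]
    ext j
    rw [Finsupp.single_apply]
    change _ = ((DFinsupp.single i (⟨1⟩ : ULift.{u} (ZMod 2)) :
      Π₀ _ : I, ULift.{u} (ZMod 2)) j).down
    rw [DFinsupp.single_apply]
    split_ifs with hij
    · subst hij; rfl
    · rfl
  rw [Module.Basis.map_apply, LinearEquiv.symm_apply_eq, hb]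
  exact (congr($(h).hom ⟨1⟩)).symm

/-- The degree-zero homology class of a vertex of a simplicial set. -/
noncomputable def vertexClass (X : SSet.{u}) (x : X.obj (.op (.mk 0))) :
    (X.homology coefficients.{u} 0 : ModuleCat.{u} (ZMod 2)) :=
  ModuleCat.Hom.hom ((X.chainComplex coefficients.{u}).liftCycles
    (X.ιChainComplex (R := coefficients.{u}) x) 0 (by simp) (by simp) ≫
      (X.chainComplex coefficients).homologyπ 0) ⟨1⟩

theorem homologyMap_vertexClass {X Y : SSet.{u}} (f : X ⟶ Y) (x : X.obj (.op (.mk 0))) :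
    (SSet.homologyMap f coefficients 0).hom (vertexClass X x) = vertexClass Y (f.app _ x) := by
  have h : ((X.chainComplex coefficients).liftCycles
      (X.ιChainComplex (R := coefficients.{u}) x) 0 (by simp) (by simp) ≫
      (X.chainComplex coefficients).homologyπ 0) ≫ SSet.homologyMap f coefficients 0 =
      (Y.chainComplex coefficients).liftCycles (Y.ιChainComplex (R := coefficients.{u}) (f.app _ x)) 0
        (by simp) (by simp) ≫ (Y.chainComplex coefficients).homologyπ 0 := by
    rw [Category.assoc, HomologicalComplex.homologyπ_naturality, ← Category.assoc,
      HomologicalComplex.liftCycles_comp_cyclesMap]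
    simp only [SSet.ι_chainComplexMap_f]
  exact congr($(h).hom ⟨1⟩)

theorem exists_basis_vertexClass (X : SSet.{u}) :
    ∃ b : Module.Basis X.π₀ (ZMod 2) (X.homology coefficients.{u} 0 : ModuleCat.{u} (ZMod 2)),
      ∀ x, b (.mk x) = vertexClass X x := by
  obtain ⟨b, hb⟩ := exists_basis_sigma X.π₀
  refine ⟨b.map (X.homology₀Iso coefficients).toLinearEquiv.symm, fun x => ?_⟩
  rw [Module.Basis.map_apply, LinearEquiv.symm_apply_eq, hb]
  have h := X.liftCycles_ιChainComplex_homologyπ_homology₀Iso_hom coefficients x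
  rw [← Category.assoc] at h
  exact (congr($(h).hom ⟨1⟩)).symm

/-- The degree-zero homology class of a point. -/
noncomputable def pointClass (Y : TopCat.{u}) (y : Y) : (homologyMod2 0).obj Y :=
  vertexClass (TopCat.toSSet.obj Y) (TopCat.toSSetObj₀Equiv.symm y)

theorem map_pointClass {Y Y' : TopCat.{u}} (f : Y ⟶ Y') (y : Y) :
    ((homologyMod2 0).map f).hom (pointClass Y y) = pointClass Y' (f y) :=
  homologyMap_vertexClass (TopCat.toSSet.map f) _

/-- Path components of a space correspond to components of its singular simplicial set, whose
degree-zero homology is free on them. -/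
theorem exists_basis_pointClass (Y : TopCat.{u}) :
    ∃ b : Module.Basis (ZerothHomotopy Y) (ZMod 2) ((homologyMod2 0).obj Y),
      ∀ y, b (.mk y) = pointClass Y y := by
  obtain ⟨b, hb⟩ := exists_basis_vertexClass (TopCat.toSSet.obj Y)
  refine ⟨b.reindex TopCat.zerothHomotopyEquiv.symm, fun y => ?_⟩
  exact (b.reindex_apply _ _).trans (hb _)

theorem pointClass_eq_of_joined {Y : TopCat.{u}} {y y' : Y} (h : Joined y y') :
    pointClass Y y = pointClass Y y' := by
  obtain ⟨b, hb⟩ := exists_basis_pointClass Y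
  rw [← hb, ← hb, ZerothHomotopy.sound h.somePath]

/-! ### Homology in positive degrees -/

/-- Homotopic maps agree on homology. -/
theorem homologyMod2_map_eq {Y Y' : TopCat.{u}} {f g : Y ⟶ Y'}
    (h : ContinuousMap.Homotopic f.hom g.hom) (k : ℕ) :
    (homologyMod2 k).map f = (homologyMod2 k).map g :=
  TopCat.Homotopy.congr_homologyMap_singularChainComplexFunctor h.some coefficients k

/-- If the simplices mapped by `f₁`, `f₂`, `g₁`, `g₂` satisfy `f₁ - f₂ = g₁ - g₂`, then the maps
on homology do, too. -/
theorem homologyMod2_map_sub_eq {Y Y' : TopCat.{u}} {f₁ f₂ g₁ g₂ : Y ⟶ Y'}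
    (h : ∀ (n : ℕ) (σ : C(stdSimplex ℝ (Fin (n + 1)), Y)),
      (f₁.hom.comp σ = f₂.hom.comp σ ∧ g₁.hom.comp σ = g₂.hom.comp σ) ∨
      (f₁.hom.comp σ = g₁.hom.comp σ ∧ f₂.hom.comp σ = g₂.hom.comp σ)) (k : ℕ) :
    (homologyMod2 k).map f₁ - (homologyMod2 k).map f₂ =
      (homologyMod2 k).map g₁ - (homologyMod2 k).map g₂ := by
  let F : (Y ⟶ Y') → (((TopCat.toSSet.obj Y).chainComplex coefficients.{u}) ⟶
    ((TopCat.toSSet.obj Y').chainComplex coefficients.{u})) :=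
    fun f => SSet.chainComplexMap (TopCat.toSSet.map f) coefficients
  have key : F f₁ - F f₂ = F g₁ - F g₂ := by
    ext n : 1
    refine SSet.chainComplex_hom_ext fun x => ?_
    have hx : ∀ f : Y ⟶ Y', (TopCat.toSSet.map f).app _ x =
        (TopCat.toSSetObjEquiv Y' _).symm (f.hom.comp (TopCat.toSSetObjEquiv Y _ x)) := fun f => rfl
    simp only [F, HomologicalComplex.sub_f_apply, Preadditive.comp_sub, SSet.ι_chainComplexMap_f,
      hx]
    rcases h n (TopCat.toSSetObjEquiv Y _ x) with ⟨h₁, h₂⟩ | ⟨h₁, h₂⟩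
    · erw [h₁, h₂]; simp
    · erw [h₁, h₂]
  have := congr(HomologicalComplex.homologyMap $key k)
  rw [HomologicalComplex.homologyMap_sub, HomologicalComplex.homologyMap_sub] at this
  exact this

/-- In positive degrees, a disjoint point does not change homology. -/
theorem isIso_homologyMod2_map_of_disjoint_point {X W : TopCat.{u}} (i : X ⟶ W)
    (hi : Topology.IsOpenEmbedding i) (p : W) (hp : IsOpen {p}) (hr : Set.range i = {p}ᶜ)
    {k : ℕ} (hk : k ≠ 0) : IsIso ((homologyMod2 k).map i) := by
  have hp' : ∀ x, i x ≠ p := fun x => by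
    have : i x ∈ Set.range i := ⟨x, rfl⟩
    rwa [hr] at this
  have hiW : ∀ w, w ≠ p → ∃ x, i x = w := fun w hw => by
    have : w ∈ Set.range i := by rwa [hr]
    exact this
  -- An empty `X` offers no point to retract onto. In that case `W` is the single point `p`, and
  -- both homology modules vanish in degree `k`.
  rcases isEmpty_or_nonempty X with hX | ⟨⟨x₀⟩⟩
  · have hW : Subsingleton W := ⟨fun a b => by
      have h : ∀ w, w = p := fun w => by
        by_contra hw
        exact hX.elim (hiW w hw).choose
      rw [h a, h b]⟩
    exact Limits.isIso_of_isInitial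
      (isZero_singularHomologyFunctor_of_totallyDisconnectedSpace _ k _ X hk).isInitial
      (isZero_singularHomologyFunctor_of_totallyDisconnectedSpace _ k _ W hk).isInitial _
  · let e₀ : X ⊕ Unit → W := Sum.elim i fun _ => p
    have hc : Continuous e₀ := i.hom.continuous.sumElim continuous_const
    have ho : IsOpenMap e₀ := hi.isOpenMap.sumElim fun U _ => by
      rcases Set.eq_empty_or_nonempty U with rfl | h
      · simp
      · rwa [h.image_const]
    have hb : Function.Bijective e₀ := by
      constructor
      · rintro (x | _) (y | _) h
        · exact congrArg _ (hi.injective h)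
        · exact absurd h (hp' x)
        · exact absurd h.symm (hp' y)
        · rfl
      · intro w
        by_cases hw : w = p
        · exact ⟨.inr (), hw.symm⟩
        · obtain ⟨x, hx⟩ := hiW w hw
          exact ⟨.inl x, hx⟩
    let e : X ⊕ Unit ≃ₜ W := (Equiv.ofBijective e₀ hb).toHomeomorphOfContinuousOpen hc ho
    have hei : ∀ x, e.symm (i x) = .inl x := fun x => e.symm_apply_apply (.inl x)
    have hep : e.symm p = .inr () := e.symm_apply_apply (.inr ())
    -- `r` retracts `W` onto `X` by moving `p` to `x₀`, and `q` records whether a point is `p`.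
    -- Since `r` is a left inverse of `i`, only the effect of `r ≫ i` on homology has to be found.
    let r : W ⟶ X := TopCat.ofHom ⟨fun w => Sum.elim id (fun _ => x₀) (e.symm w),
      (continuous_id.sumElim continuous_const).comp e.symm.continuous⟩
    let q : W ⟶ TopCat.of (ULift.{u} Bool) := TopCat.ofHom
      ⟨fun w => Sum.elim (fun _ => ⟨false⟩) (fun _ => ⟨true⟩) (e.symm w),
        (continuous_const.sumElim continuous_const).comp e.symm.continuous⟩
    let s : TopCat.of (ULift.{u} Bool) ⟶ W :=
      TopCat.ofHom ⟨fun b => if b.down then p else i x₀, continuous_of_discreteTopology⟩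
    let s' : TopCat.of (ULift.{u} Bool) ⟶ W := TopCat.ofHom ⟨fun _ => i x₀, continuous_const⟩
    have hr₁ : ∀ x, r (i x) = x := fun x => by
      change Sum.elim id (fun _ => x₀) (e.symm (i x)) = x
      rw [hei]; rfl
    have hr₂ : r p = x₀ := by
      change Sum.elim id (fun _ => x₀) (e.symm p) = x₀
      rw [hep]; rfl
    have hq₁ : ∀ x, q (i x) = ⟨false⟩ := fun x => by
      change Sum.elim (fun _ => (⟨false⟩ : ULift.{u} Bool)) (fun _ => ⟨true⟩) (e.symm (i x)) = _
      rw [hei]; rfl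
    have hq₂ : q p = ⟨true⟩ := by
      change Sum.elim (fun _ => (⟨false⟩ : ULift.{u} Bool)) (fun _ => ⟨true⟩) (e.symm p) = _
      rw [hep]; rfl
    -- A singular simplex either is constant at `p` or misses `p`, by connectedness. On chains, `r ≫
    -- i` therefore differs from the identity exactly as `q ≫ s'` differs from `q ≫ s`, and these
    -- two factor through a discrete space without homology in degree `k`.
    have key := homologyMod2_map_sub_eq (f₁ := r ≫ i) (f₂ := 𝟙 W) (g₁ := q ≫ s') (g₂ := q ≫ s)
      (fun n σ => by
        have hconst : ∀ a b, q (σ a) = q (σ b) := fun a b =>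
          PreconnectedSpace.constant inferInstance (q.hom.continuous.comp σ.continuous)
        by_cases h : ∃ a, σ a = p
        · obtain ⟨a, ha⟩ := h
          have hσ : ∀ b, σ b = p := fun b => by
            by_contra hb
            obtain ⟨x, hx⟩ := hiW _ hb
            have := hconst a b
            rw [ha, ← hx, hq₁, hq₂] at this
            cases this
          refine Or.inr ⟨?_, ?_⟩
          · ext b
            change i (r (σ b)) = i x₀
            rw [hσ, hr₂]
          · ext b
            change σ b = s (q (σ b))
            rw [hσ, hq₂]; rfl
        · push Not at h
          refine Or.inl ⟨?_, ?_⟩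
          · ext b
            obtain ⟨x, hx⟩ := hiW _ (h b)
            change i (r (σ b)) = σ b
            rw [← hx, hr₁]
          · ext b
            obtain ⟨x, hx⟩ := hiW _ (h b)
            change i x₀ = s (q (σ b))
            rw [← hx, hq₁]; rfl) k
    have hz := isZero_singularHomologyFunctor_of_totallyDisconnectedSpace
      (ModuleCat.{u} (ZMod 2)) k coefficients (TopCat.of (ULift.{u} Bool)) hk
    have hz' : ∀ t : TopCat.of (ULift.{u} Bool) ⟶ W, (homologyMod2 k).map t = 0 :=
      fun t => hz.eq_of_src _ _
    rw [Functor.map_comp, Functor.map_comp, Functor.map_comp, hz', hz', sub_self, sub_eq_zero,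
      CategoryTheory.Functor.map_id] at key
    refine ⟨(homologyMod2 k).map r, ?_, key⟩
    rw [← Functor.map_comp, ← CategoryTheory.Functor.map_id]
    congr 1
    ext x
    exact hr₁ x

/-! ### Homotopies between maps of realizations -/

/-- With the sum taken over all coordinates, a face is needed only to bound the support. This form
suits convex combinations and normalization. -/
theorem mem_realization_iff {W : Type u} [Fintype W] {K : SComplex W} {x : W → ℝ} :
    x ∈ realization K ↔ (∀ v, 0 ≤ x v) ∧ ∑ v, x v = 1 ∧ ∃ s ∈ K, ∀ v, v ∉ s → x v = 0 := by
  have hsum : ∀ s : Finset W, (∀ v, v ∉ s → x v = 0) → ∑ v ∈ s, x v = ∑ v, x v := fun s hs =>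
    Finset.sum_subset (Finset.subset_univ s) fun v _ hv => hs v hv
  constructor
  · rintro ⟨s, hs, h₁, h₂, h₃⟩
    exact ⟨h₁, (hsum s h₂).symm.trans h₃, s, hs, h₂⟩
  · rintro ⟨h₁, h₂, s, hs, h₃⟩
    exact ⟨s, hs, h₁, h₃, (hsum s h₃).trans h₂⟩

/-- A homotopy that respects an equivalence relation induces a homotopy on the quotient. -/
theorem homotopic_of_quotient {X Y : Type u} [TopologicalSpace X] [TopologicalSpace Y]
    {r : Setoid X} {f g : C(Quotient r, Y)} (H : C(unitInterval × X, Y))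
    (h₀ : ∀ x, H (0, x) = f (Quotient.mk r x)) (h₁ : ∀ x, H (1, x) = g (Quotient.mk r x))
    (hr : ∀ x y, r x y → ∀ t, H (t, x) = H (t, y)) : f.Homotopic g := by
  -- Currying avoids the question whether the product of the interval with a quotient map is a
  -- quotient map: a map from `X` into the path space descends to the quotient directly.
  let c : C(X, C(unitInterval, Y)) := (H.comp .prodSwap).curry
  let c' : C(Quotient r, C(unitInterval, Y)) :=
    ⟨Quotient.lift c fun x y h => ContinuousMap.ext fun t => hr x y h t,
      c.continuous.quotient_lift _⟩
  exact ⟨⟨c'.uncurry.comp .prodSwap, fun x => by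
    induction x using Quotient.inductionOn; exact h₀ _, fun x => by
    induction x using Quotient.inductionOn; exact h₁ _⟩⟩

/-- The straight-line homotopy between maps such that the images of a point lie in a common
simplex. -/
noncomputable def straightLine {W : Type u} [Fintype W] {Y : Type u} [TopologicalSpace Y]
    {Z : SComplex W} (f g : C(Y, realization Z))
    (h : ∀ y, ∃ s ∈ Z, ∀ v, v ∉ s → (f y : W → ℝ) v = 0 ∧ (g y : W → ℝ) v = 0) :
    f.Homotopy g where
  toFun p := ⟨fun v => (1 - (p.1 : ℝ)) * (f p.2 : W → ℝ) v + p.1 * (g p.2 : W → ℝ) v, by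
    obtain ⟨s, hs, hv⟩ := h p.2
    have hf := mem_realization_iff.1 (f p.2).2
    have hg := mem_realization_iff.1 (g p.2).2
    refine mem_realization_iff.2 ⟨fun v => ?_, ?_, s, hs, fun v h => ?_⟩
    · exact add_nonneg (mul_nonneg (sub_nonneg.2 p.1.2.2) (hf.1 v)) (mul_nonneg p.1.2.1 (hg.1 v))
    · rw [Finset.sum_add_distrib, ← Finset.mul_sum, ← Finset.mul_sum, hf.2.1, hg.2.1]
      ring
    · rw [(hv v h).1, (hv v h).2]
      ring⟩
  continuous_toFun := by
    refine Continuous.subtype_mk (continuous_pi fun v => ?_) _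
    have hf : Continuous fun p : unitInterval × Y => (f p.2 : W → ℝ) v :=
      (continuous_apply v).comp (continuous_subtype_val.comp (f.continuous.comp continuous_snd))
    have hg : Continuous fun p : unitInterval × Y => (g p.2 : W → ℝ) v :=
      (continuous_apply v).comp (continuous_subtype_val.comp (g.continuous.comp continuous_snd))
    have ht : Continuous fun p : unitInterval × Y => (p.1 : ℝ) :=
      continuous_subtype_val.comp continuous_fst
    exact ((continuous_const.sub ht).mul hf).add (ht.mul hg)
  map_zero_left x := by ext v; simp
  map_one_left x := by ext v; simp

/-- The projection onto the space in which a subcomplex is contracted. -/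
def contractProj {V : Type u} (X A : SComplex V) :
    TopCat.of (realization X) ⟶ TopCat.of (ContractedSpace X A) :=
  TopCat.ofHom ⟨Quotient.mk _, continuous_quotient_mk'⟩

theorem contractProj_eq {V : Type u} {X A : SComplex V} {x y : realization X}
    (hx : (x : V → ℝ) ∈ realization A) (hy : (y : V → ℝ) ∈ realization A) :
    contractProj X A x = contractProj X A y :=
  Quotient.sound (Or.inr ⟨hx, hy⟩)

theorem isQuotientMap_contractProj {V : Type u} (X A : SComplex V) :
    Topology.IsQuotientMap (contractProj X A) :=
  isQuotientMap_quotient_mk'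

/-- A self-map of `|Z|` which preserves `|C|` induces a self-map of `|Z| / |C|`. -/
def contractEnd {W : Type u} {Z C : SComplex W} (f : C(realization Z, realization Z))
    (hf : ∀ z : realization Z, (z : W → ℝ) ∈ realization C → (f z : W → ℝ) ∈ realization C) :
    C(ContractedSpace Z C, ContractedSpace Z C) where
  toFun := Quotient.map' f (by
    rintro x y (rfl | ⟨h, h'⟩)
    · exact Or.inl rfl
    · exact Or.inr ⟨hf _ h, hf _ h'⟩)
  continuous_toFun := Continuous.quotient_map' f.continuous _

/-- By `hC` the straight-line homotopy keeps |C| inside |C| at all times, so it respects the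
identification and descends. -/
theorem contractEnd_homotopic {W : Type u} [Fintype W] {Z C : SComplex W}
    {f g : C(realization Z, realization Z)}
    (hf : ∀ z : realization Z, (z : W → ℝ) ∈ realization C → (f z : W → ℝ) ∈ realization C)
    (hg : ∀ z : realization Z, (z : W → ℝ) ∈ realization C → (g z : W → ℝ) ∈ realization C)
    (hZ : ∀ z, ∃ s ∈ Z, ∀ v, v ∉ s → (f z : W → ℝ) v = 0 ∧ (g z : W → ℝ) v = 0)
    (hC : ∀ z : realization Z, (z : W → ℝ) ∈ realization C →
      ∃ s ∈ C, ∀ v, v ∉ s → (f z : W → ℝ) v = 0 ∧ (g z : W → ℝ) v = 0) :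
    (contractEnd f hf).Homotopic (contractEnd g hg) := by
  let L := straightLine f g hZ
  have hL : ∀ z : realization Z, (z : W → ℝ) ∈ realization C → ∀ t, (L (t, z) : W → ℝ) ∈ realization C := by
    intro z hz t
    obtain ⟨s, hs, hv⟩ := hC z hz
    have h := mem_realization_iff.1 (L (t, z)).2
    refine mem_realization_iff.2 ⟨h.1, h.2.1, s, hs, fun v hvs => ?_⟩
    change (1 - (t : ℝ)) * (f z : W → ℝ) v + t * (g z : W → ℝ) v = 0
    rw [(hv v hvs).1, (hv v hvs).2]
    ring
  refine homotopic_of_quotient ((contractProj Z C).hom.comp L.toContinuousMap) (fun x => ?_)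
    (fun x => ?_) (fun x y h t => ?_)
  · exact congrArg (contractProj Z C) (L.map_zero_left x)
  · exact congrArg (contractProj Z C) (L.map_one_left x)
  · rcases h with rfl | ⟨hx, hy⟩
    · rfl
    · exact contractProj_eq (hL x hx t) (hL y hy t)

/-- If `|Z|` can be deformed into itself, in two straight steps, such that `|C|` is moved inside
itself to a single point, then collapsing `|C|` preserves homology. -/
theorem isIso_homologyMod2_map_contractProj {W : Type u} [Fintype W] {Z C : SComplex W}
    {f g : C(realization Z, realization Z)}
    (hZ : ∀ z : realization Z, ∃ s ∈ Z, ∀ v, v ∉ s → (z : W → ℝ) v = 0 ∧ (f z : W → ℝ) v = 0)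
    (hC : ∀ z : realization Z, (z : W → ℝ) ∈ realization C →
      ∃ s ∈ C, ∀ v, v ∉ s → (z : W → ℝ) v = 0 ∧ (f z : W → ℝ) v = 0)
    (hZ' : ∀ z, ∃ s ∈ Z, ∀ v, v ∉ s → (f z : W → ℝ) v = 0 ∧ (g z : W → ℝ) v = 0)
    (hC' : ∀ z : realization Z, (z : W → ℝ) ∈ realization C →
      ∃ s ∈ C, ∀ v, v ∉ s → (f z : W → ℝ) v = 0 ∧ (g z : W → ℝ) v = 0)
    (hg : ∀ z z' : realization Z, (z : W → ℝ) ∈ realization C → (z' : W → ℝ) ∈ realization C → g z = g z')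
    (k : ℕ) : IsIso ((homologyMod2 k).map (contractProj Z C)) := by
  have hfC : ∀ z : realization Z, (z : W → ℝ) ∈ realization C → (f z : W → ℝ) ∈ realization C := fun z hz => by
    obtain ⟨s, hs, hv⟩ := hC z hz
    have h := mem_realization_iff.1 (f z).2
    exact mem_realization_iff.2 ⟨h.1, h.2.1, s, hs, fun v h => (hv v h).2⟩
  have hgC : ∀ z : realization Z, (z : W → ℝ) ∈ realization C → (g z : W → ℝ) ∈ realization C := fun z hz => by
    obtain ⟨s, hs, hv⟩ := hC' z hz
    have h := mem_realization_iff.1 (g z).2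
    exact mem_realization_iff.2 ⟨h.1, h.2.1, s, hs, fun v h => (hv v h).2⟩
  -- The homotopy inverse: `g` is constant on |C| and so factors through the quotient. One composite
  -- is `g`, the other is induced by `g`, and both are homotopic to the identity by way of `f`.
  let G : TopCat.of (ContractedSpace Z C) ⟶ TopCat.of (realization Z) := TopCat.ofHom
    ⟨Quotient.lift g (by
      rintro x y (rfl | ⟨h, h'⟩)
      · rfl
      · exact hg x y h h'), g.continuous.quotient_lift _⟩
  have e₁ : contractProj Z C ≫ G = TopCat.ofHom g := rfl
  have e₂ : G ≫ contractProj Z C = TopCat.ofHom (contractEnd g hgC) := by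
    ext x
    induction x using Quotient.inductionOn
    rfl
  have e₃ : TopCat.ofHom (contractEnd (C := C) (.id (realization Z)) fun _ h => h) =
      𝟙 (TopCat.of (ContractedSpace Z C)) := by
    ext x
    induction x using Quotient.inductionOn
    rfl
  refine ⟨(homologyMod2 k).map G, ?_, ?_⟩
  · rw [← Functor.map_comp, ← CategoryTheory.Functor.map_id, e₁]
    refine homologyMod2_map_eq ?_ k
    exact ⟨(straightLine f g hZ').symm.trans (straightLine (.id _) f hZ).symm⟩
  · rw [← Functor.map_comp, ← CategoryTheory.Functor.map_id, e₂, ← e₃]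
    refine homologyMod2_map_eq ?_ k
    exact (contractEnd_homotopic hfC hgC hZ' hC').symm.trans
      (contractEnd_homotopic (f := .id _) (fun _ h => h) hfC hZ hC).symm

/-! ### Collapsing the cone -/

section Cone

variable {V : Type u}

theorem coneOff_self_le (X A : SComplex V) (h : A ≤ X) : coneOff A A ≤ coneOff X A :=
  coneOff_mono h le_rfl

theorem mem_of_subset {K : SComplex V} {s t : Finset V} (hs : s ∈ K) (h : t ⊆ s)
    (ht : t.Nonempty) : t ∈ K :=
  (K.isRelLowerSet_faces hs).2 h ht

theorem nonempty_of_mem {K : SComplex V} {s : Finset V} (hs : s ∈ K) : s.Nonempty :=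
  (K.isRelLowerSet_faces hs).1

/-- A face of the cone contains no non-empty set of vertices outside of the base. -/
theorem mem_of_subset_eraseNone {A : SComplex V} {T : Finset (Option V)} (hT : T ∈ coneOff A A)
    {F : Finset V} (hF : F ⊆ Finset.eraseNone T) (hF' : F.Nonempty) : F ∈ A := by
  rcases hT with ⟨_, h | h⟩ | ⟨_, h | h⟩
  · exact mem_of_subset h hF hF'
  · exact mem_of_subset h hF hF'
  · rw [h, Finset.subset_empty] at hF
    exact absurd hF hF'.ne_empty
  · exact mem_of_subset h hF hF'

theorem mem_coneOff_self_of_none_mem {X A : SComplex V} {T : Finset (Option V)}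
    (hT : T ∈ coneOff X A) (h : none ∈ T) : T ∈ coneOff A A := by
  rcases hT with ⟨h', _⟩ | h'
  · exact absurd h h'
  · exact Or.inr h'

variable [Fintype V]

open scoped Classical in
/-- A continuous measure for the distance from a subcomplex; the vertices whose coordinates
exceed it span a face of the subcomplex. -/
noncomputable def threshold (A : SComplex V) (z : Option V → ℝ) : ℝ :=
  ∑ F : Finset V, if h : F.Nonempty ∧ F ∉ A then F.inf' h.1 (fun v => z (some v)) else 0

theorem continuous_threshold (A : SComplex V) : Continuous (threshold A) := by
  classical
  refine continuous_finsetSum _ fun F _ => ?_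
  by_cases h : F.Nonempty ∧ F ∉ A
  · simp only [dif_pos h]
    exact Continuous.finset_inf'_apply h.1 fun v _ => continuous_apply _
  · simp only [dif_neg h]
    exact continuous_const

theorem threshold_nonneg (A : SComplex V) {z : Option V → ℝ} (hz : ∀ v, 0 ≤ z v) :
    0 ≤ threshold A z := by
  classical
  refine Finset.sum_nonneg fun F _ => ?_
  split_ifs with h
  · exact Finset.le_inf' _ _ fun v _ => hz _
  · exact le_rfl

/-- If `F` were not a face of `A`, its least coordinate would be one of the non-negative summands of
the threshold and could not exceed the sum. -/
theorem mem_of_threshold_lt (A : SComplex V) {z : Option V → ℝ} (hz : ∀ v, 0 ≤ z v)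
    {F : Finset V} (hF : F.Nonempty) (h : ∀ v ∈ F, threshold A z < z (some v)) : F ∈ A := by
  classical
  by_contra hA
  have h₁ : threshold A z < F.inf' hF fun v => z (some v) :=
    (Finset.lt_inf'_iff _).2 h
  refine h₁.not_ge ?_
  have := Finset.single_le_sum (s := Finset.univ)
    (f := fun F : Finset V => if h : F.Nonempty ∧ F ∉ A then
      F.inf' h.1 (fun v => z (some v)) else 0)
    (fun G _ => by
      split_ifs with h
      · exact Finset.le_inf' _ _ fun v _ => hz _
      · exact le_rfl) (Finset.mem_univ F)
  have hFA : F.Nonempty ∧ F ∉ A := ⟨hF, hA⟩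
  rw [dif_pos hFA] at this
  exact this

/-- A non-face of `A` is not contained in the base of a face of the cone, so it has a vertex outside
the support of `z` and its least coordinate is zero. -/
theorem threshold_eq_zero {A : SComplex V} {z : Option V → ℝ}
    (hz : z ∈ realization (coneOff A A)) : threshold A z = 0 := by
  classical
  obtain ⟨h₀, _, T, hT, hzT⟩ := mem_realization_iff.1 hz
  refine Finset.sum_eq_zero fun F _ => ?_
  split_ifs with h
  · have : ¬ F ⊆ Finset.eraseNone T := fun hF => h.2 (mem_of_subset_eraseNone hT hF h.1)
    obtain ⟨v, hv, hv'⟩ := Finset.not_subset.1 this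
    rw [Finset.mem_eraseNone] at hv'
    refine le_antisymm ?_ (Finset.le_inf' _ _ fun v _ => h₀ _)
    exact (Finset.inf'_le _ hv).trans_eq (hzT _ hv')
  · rfl

/-- The mass of the part of `z` above the threshold. -/
noncomputable def upperMass (A : SComplex V) (z : Option V → ℝ) : ℝ :=
  ∑ v, max (z (some v) - threshold A z) 0

/-- The mass of the part of `z` below the threshold. -/
noncomputable def lowerMass (A : SComplex V) (z : Option V → ℝ) : ℝ :=
  ∑ v, min (z (some v)) (threshold A z)

theorem continuous_upperMass (A : SComplex V) : Continuous (upperMass A) :=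
  continuous_finsetSum _ fun _ _ =>
    ((continuous_apply _).sub (continuous_threshold A)).max continuous_const

theorem continuous_lowerMass (A : SComplex V) : Continuous (lowerMass A) :=
  continuous_finsetSum _ fun _ _ => (continuous_apply _).min (continuous_threshold A)

theorem upperMass_nonneg (A : SComplex V) (z : Option V → ℝ) : 0 ≤ upperMass A z :=
  Finset.sum_nonneg fun _ _ => le_max_right _ _

theorem lowerMass_nonneg (A : SComplex V) {z : Option V → ℝ} (hz : ∀ v, 0 ≤ z v) :
    0 ≤ lowerMass A z :=
  Finset.sum_nonneg fun _ _ => le_min (hz _) (threshold_nonneg A hz)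

theorem none_add_upperMass_add_lowerMass (A : SComplex V) (z : Option V → ℝ) :
    z none + upperMass A z + lowerMass A z = ∑ v, z v := by
  rw [Fintype.sum_option, add_assoc, upperMass, lowerMass, ← Finset.sum_add_distrib]
  congr 1
  refine Finset.sum_congr rfl fun v _ => ?_
  rcases le_total (z (some v)) (threshold A z) with h | h
  · rw [max_eq_right (by linarith), min_eq_left h, zero_add]
  · rw [max_eq_left (by linarith), min_eq_right h]
    ring

theorem lowerMass_eq_zero {A : SComplex V} {z : Option V → ℝ}
    (hz : z ∈ realization (coneOff A A)) : lowerMass A z = 0 := by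
  refine Finset.sum_eq_zero fun v _ => ?_
  rw [threshold_eq_zero hz]
  exact min_eq_right ((mem_realization_iff.1 hz).1 _)

/-- Reweighting the parts of `z` above and below the threshold. -/
noncomputable def reweight (A : SComplex V) (p q r : (Option V → ℝ) → ℝ) (z : Option V → ℝ) :
    Option V → ℝ
  | none => z none + r z
  | some v => p z * max (z (some v) - threshold A z) 0 + q z * min (z (some v)) (threshold A z)

theorem continuous_reweight (A : SComplex V) {p q r : (Option V → ℝ) → ℝ} (hp : Continuous p)
    (hq : Continuous q) (hr : Continuous r) : Continuous (reweight A p q r) := by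
  refine continuous_pi fun v => ?_
  cases v with
  | none => exact (continuous_apply _).add hr
  | some v =>
    exact (hp.mul (((continuous_apply _).sub (continuous_threshold A)).max continuous_const)).add
      (hq.mul ((continuous_apply _).min (continuous_threshold A)))

theorem sum_reweight (A : SComplex V) (p q r : (Option V → ℝ) → ℝ) (z : Option V → ℝ) :
    ∑ v, reweight A p q r z v =
      z none + r z + p z * upperMass A z + q z * lowerMass A z := by
  rw [Fintype.sum_option, add_assoc (z none + r z), upperMass, lowerMass, Finset.mul_sum,
    Finset.mul_sum, ← Finset.sum_add_distrib]
  rfl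

theorem reweight_nonneg (A : SComplex V) {p q r : (Option V → ℝ) → ℝ} {z : Option V → ℝ}
    (hz : ∀ v, 0 ≤ z v) (hp : 0 ≤ p z) (hq : 0 ≤ q z) (hr : 0 ≤ r z) (v : Option V) :
    0 ≤ reweight A p q r z v := by
  cases v with
  | none => exact add_nonneg (hz _) hr
  | some v =>
    exact add_nonneg (mul_nonneg hp (le_max_right _ _)) (mul_nonneg hq (le_min (hz _) (threshold_nonneg A hz)))

theorem reweight_some_eq_zero (A : SComplex V) {p q r : (Option V → ℝ) → ℝ} {z : Option V → ℝ}
    (hz : ∀ v, 0 ≤ z v) {v : V} (h : z (some v) = 0) : reweight A p q r z (some v) = 0 := by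
  have := threshold_nonneg A hz
  simp only [reweight, h]
  rw [max_eq_right (by linarith), min_eq_left this]
  ring

/-- The span of `v₊` and of the vertices above the threshold. -/
theorem exists_face_of_threshold (A : SComplex V) {z : Option V → ℝ} (hz : ∀ v, 0 ≤ z v) :
    ∃ s ∈ coneOff A A, none ∈ s ∧ ∀ v, some v ∉ s → z (some v) ≤ threshold A z := by
  classical
  refine ⟨Finset.univ.filter fun v : Option V => v = none ∨ threshold A z < z v,
    Or.inr ⟨by simp, ?_⟩, by simp, fun v hv => by simpa using hv⟩
  rw [or_iff_not_imp_left]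
  intro h
  refine mem_of_threshold_lt A hz (Finset.nonempty_iff_ne_empty.2 h) fun v hv => ?_
  simpa using hv

variable {X A : SComplex V}

/-- Reweighting, followed by normalization. -/
noncomputable def reweightMap (hA : A ≤ X) (p q r : (Option V → ℝ) → ℝ) (hp : Continuous p)
    (hq : Continuous q) (hr : Continuous r)
    (h₀ : ∀ z ∈ realization (coneOff X A), 0 ≤ p z ∧ 0 ≤ q z ∧ 0 ≤ r z ∧
      0 < z none + r z + p z * upperMass A z + q z * lowerMass A z ∧
      (q z ≠ 0 → r z = 0)) : C(realization (coneOff X A), realization (coneOff X A)) where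
  toFun z := ⟨fun v => reweight A p q r z v / ∑ v, reweight A p q r z v, by
    obtain ⟨h₁, h₂, h₃, h₄, h₅⟩ := h₀ z z.2
    obtain ⟨hz, _, T, hT, hzT⟩ := mem_realization_iff.1 z.2
    rw [← sum_reweight] at h₄
    refine mem_realization_iff.2 ⟨fun v => div_nonneg (reweight_nonneg A hz h₁ h₂ h₃ v) h₄.le, ?_, ?_⟩
    · rw [← Finset.sum_div, div_self h₄.ne']
    · by_cases hq0 : q (z : Option V → ℝ) = 0
      · obtain ⟨s, hs, hn, hs'⟩ := exists_face_of_threshold A hz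
        refine ⟨s, coneOff_self_le X A hA hs, fun v hv => ?_⟩
        cases v with
        | none => exact absurd hn hv
        | some v =>
          simp only [reweight, hq0]
          rw [max_eq_right (by linarith [hs' v hv])]
          simp
      · refine ⟨T, hT, fun v hv => ?_⟩
        rw [div_eq_zero_iff]
        left
        cases v with
        | none => simp only [reweight, h₅ hq0, hzT _ hv, add_zero]
        | some v => exact reweight_some_eq_zero A hz (hzT _ hv)⟩
  continuous_toFun := by
    have hc := (continuous_reweight A hp hq hr).comp
      (continuous_subtype_val (p := (· ∈ realization (coneOff X A))))
    have hs : Continuous fun z : realization (coneOff X A) => ∑ v, reweight A p q r z v :=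
      continuous_finsetSum _ fun v _ => (continuous_apply v).comp hc
    refine Continuous.subtype_mk (continuous_pi fun v => ?_) _
    refine ((continuous_apply v).comp hc).div hs fun z => ?_
    rw [sum_reweight]
    exact (h₀ z z.2).2.2.2.1.ne'

theorem reweightMap_apply (hA : A ≤ X) {p q r : (Option V → ℝ) → ℝ} {hp : Continuous p}
    {hq : Continuous q} {hr : Continuous r} {h₀} (z : realization (coneOff X A)) (v : Option V) :
    (reweightMap hA p q r hp hq hr h₀ z : Option V → ℝ) v =
      reweight A p q r z v / ∑ v, reweight A p q r z v := rfl

theorem mem_coneOff_self_of_none_ne_zero {z : Option V → ℝ} (hz : z ∈ realization (coneOff X A))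
    (h : z none ≠ 0) : z ∈ realization (coneOff A A) := by
  obtain ⟨h₀, h₁, T, hT, hzT⟩ := mem_realization_iff.1 hz
  refine mem_realization_iff.2 ⟨h₀, h₁, T, mem_coneOff_self_of_none_mem hT ?_, hzT⟩
  by_contra hn
  exact h (hzT _ hn)

/-- Collapsing the cone over the contracted part preserves homology. -/
theorem isIso_homologyMod2_map_collapseCone (hA : A ≤ X) (k : ℕ) :
    IsIso ((homologyMod2 k).map (contractProj (coneOff X A) (coneOff A A))) := by
  have hu := continuous_upperMass A
  have hl := continuous_lowerMass A
  have hκ : Continuous fun z => max (lowerMass A z - upperMass A z) 0 :=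
    (hl.sub hu).max continuous_const
  have hν : Continuous fun z => max (upperMass A z - lowerMass A z) 0 :=
    (hu.sub hl).max continuous_const
  have hpos : ∀ z ∈ realization (coneOff X A), 0 ≤ z none ∧ 0 ≤ upperMass A z ∧
      0 ≤ lowerMass A z ∧ z none + upperMass A z + lowerMass A z = 1 := fun z hz =>
    have h := mem_realization_iff.1 hz
    ⟨h.1 _, upperMass_nonneg A z, lowerMass_nonneg A h.1,
      (none_add_upperMass_add_lowerMass A z).trans h.2.1⟩
  -- Write u and l for the upper and lower mass. `f` damps the lower part by (l - u)⁺, so it pushes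
  -- the region l ≤ u into the cone. On the cone the threshold and l are zero, and `f` is the
  -- identity there.
  let f := reweightMap hA (fun _ => 1) (fun z => max (lowerMass A z - upperMass A z) 0)
    (fun _ => 0) continuous_const hκ continuous_const (fun z hz => by
      obtain ⟨h₁, h₂, h₃, h₄⟩ := hpos z hz
      refine ⟨zero_le_one, le_max_right _ _, le_rfl, ?_, fun _ => rfl⟩
      rcases le_total (upperMass A z) (lowerMass A z) with h | h
      · rw [max_eq_left (by linarith)]
        nlinarith [mul_nonneg (sub_nonneg.2 h) h₃]
      · rw [max_eq_right (by linarith)]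
        linarith)
  -- `g` also scales the upper part by l and adds (u - l)⁺ to `v₊`. On the cone l = 0, so every base
  -- coordinate vanishes and all mass goes to the apex. The factors (l - u)⁺ and (u - l)⁺ are never
  -- both non-zero, as `reweightMap` demands.
  let g := reweightMap hA (lowerMass A) (fun z => max (lowerMass A z - upperMass A z) 0)
    (fun z => max (upperMass A z - lowerMass A z) 0) hl hκ hν (fun z hz => by
      obtain ⟨h₁, h₂, h₃, h₄⟩ := hpos z hz
      refine ⟨h₃, le_max_right _ _, le_max_right _ _, ?_, fun hq => ?_⟩
      · rcases le_total (upperMass A z) (lowerMass A z) with h | h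
        · rw [max_eq_right (by linarith), max_eq_left (by linarith)]
          -- The square encodes l² ≥ l/2 - 1/16. In this case the total mass is z(v₊) + l², and
          -- z(v₊) + 2l ≥ 1, so the total is at least 1/4 - 1/16.
          nlinarith [sq_nonneg (4 * lowerMass A z - 1)]
        · rw [max_eq_left (by linarith), max_eq_right (by linarith)]
          nlinarith [sq_nonneg (4 * lowerMass A z - 1), mul_nonneg h₃ (sub_nonneg.2 h)]
      · rcases le_total (upperMass A z) (lowerMass A z) with h | h
        · exact max_eq_right (by linarith)
        · exact absurd (max_eq_right (by linarith)) hq)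
  have hid : ∀ (z : realization (coneOff X A)) (T : Finset (Option V)),
      (∀ v, v ∉ T → (z : Option V → ℝ) v = 0) → ∀ v, v ∉ T →
        (z : Option V → ℝ) v = 0 ∧ (f z : Option V → ℝ) v = 0 := by
    intro z T hT v hv
    refine ⟨hT v hv, ?_⟩
    rw [reweightMap_apply, div_eq_zero_iff]
    left
    cases v with
    | none => simp only [reweight, hT _ hv, add_zero]
    | some v => exact reweight_some_eq_zero A (mem_realization_iff.1 z.2).1 (hT _ hv)
  -- Where l ≤ u, both maps kill the lower part, so both images lie in the face spanned by `v₊` and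
  -- the vertices above the threshold.
  have hfg : ∀ z : realization (coneOff X A), lowerMass A z ≤ upperMass A z →
      ∃ s ∈ coneOff A A, ∀ v, v ∉ s → (f z : Option V → ℝ) v = 0 ∧ (g z : Option V → ℝ) v = 0 := by
    intro z h
    obtain ⟨s, hs, hn, hs'⟩ := exists_face_of_threshold A (mem_realization_iff.1 z.2).1
    refine ⟨s, hs, fun v hv => ?_⟩
    rw [reweightMap_apply, reweightMap_apply, div_eq_zero_iff, div_eq_zero_iff]
    cases v with
    | none => exact absurd hn hv
    | some v =>
      simp only [reweight]
      rw [max_eq_right (by linarith [hs' v hv] : (z : Option V → ℝ) (some v) - threshold A z ≤ 0),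
        max_eq_right (by linarith : lowerMass A z - upperMass A z ≤ 0)]
      simp
  refine isIso_homologyMod2_map_contractProj (f := f) (g := g) (fun z => ?_) (fun z hz => ?_)
    (fun z => ?_) (fun z hz => ?_) (fun z z' hz hz' => ?_) k
  · obtain ⟨_, _, T, hT, hzT⟩ := mem_realization_iff.1 z.2
    exact ⟨T, hT, hid z T hzT⟩
  · obtain ⟨_, _, T, hT, hzT⟩ := mem_realization_iff.1 hz
    exact ⟨T, hT, hid z T hzT⟩
  -- Where l > u, nothing is added to `v₊`, so a face carrying `z` carries both images.
  · rcases le_or_gt (lowerMass A (z : Option V → ℝ)) (upperMass A z) with h | h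
    · obtain ⟨s, hs, hs'⟩ := hfg z h
      exact ⟨s, coneOff_self_le X A hA hs, hs'⟩
    · obtain ⟨h₀, _, T, hT, hzT⟩ := mem_realization_iff.1 z.2
      refine ⟨T, hT, fun v hv => ⟨(hid z T hzT v hv).2, ?_⟩⟩
      rw [reweightMap_apply, div_eq_zero_iff]
      left
      cases v with
      | none =>
        simp only [reweight, hzT _ hv]
        rw [max_eq_right (by linarith), add_zero]
      | some v => exact reweight_some_eq_zero A h₀ (hzT _ hv)
  · refine hfg z ?_
    rw [lowerMass_eq_zero hz]
    exact upperMass_nonneg A z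
  · have hval : ∀ z : realization (coneOff X A), (z : Option V → ℝ) ∈ realization (coneOff A A) →
        ∀ v : V, (g z : Option V → ℝ) (some v) = 0 := by
      intro z hz v
      rw [reweightMap_apply, div_eq_zero_iff]
      left
      simp only [reweight]
      rw [lowerMass_eq_zero hz, threshold_eq_zero hz,
        min_eq_right ((mem_realization_iff.1 hz).1 _)]
      ring
    have hnone : ∀ z : realization (coneOff X A),
        (z : Option V → ℝ) ∈ realization (coneOff A A) → (g z : Option V → ℝ) none = 1 := by
      intro z hz
      have h := (mem_realization_iff.1 (g z).2).2.1
      rwa [Fintype.sum_option, Finset.sum_eq_zero fun v _ => hval z hz v, add_zero] at h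
    ext v
    cases v with
    | none => rw [hnone z hz, hnone z' hz']
    | some v => rw [hval z hz, hval z' hz']

end Cone

/-! ### Topology of realizations -/

theorem isClosed_realization {W : Type u} [Finite W] (K : SComplex W) :
    IsClosed (realization K) := by
  have := Fintype.ofFinite W
  have h : realization K = ⋃ s ∈ K.faces,
      {x : W → ℝ | (∀ v, 0 ≤ x v) ∧ ∑ v, x v = 1 ∧ ∀ v, v ∉ s → x v = 0} := by
    ext x
    rw [mem_realization_iff]
    simp only [Set.mem_iUnion, Set.mem_ofPred_eq, exists_prop]
    constructor
    · rintro ⟨h₁, h₂, s, hs, h₃⟩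
      exact ⟨s, hs, h₁, h₂, h₃⟩
    · rintro ⟨s, hs, h₁, h₂, h₃⟩
      exact ⟨h₁, h₂, s, hs, h₃⟩
  rw [h]
  refine (Set.toFinite K.faces).isClosed_biUnion fun s _ => ?_
  have h₁ : IsClosed {x : W → ℝ | ∀ v, 0 ≤ x v} := by
    rw [Set.ofPred_forall]
    exact isClosed_iInter fun v => isClosed_le continuous_const (continuous_apply v)
  have h₂ : IsClosed {x : W → ℝ | ∑ v, x v = 1} :=
    isClosed_eq (continuous_finsetSum _ fun v _ => continuous_apply v) continuous_const
  have h₃ : IsClosed {x : W → ℝ | ∀ v, v ∉ s → x v = 0} := by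
    simp only [Set.ofPred_forall]
    exact isClosed_iInter fun v => isClosed_iInter fun _ =>
      isClosed_eq (continuous_apply v) continuous_const
  exact h₁.inter (h₂.inter h₃)

theorem isCompact_realization {W : Type u} [Finite W] (K : SComplex W) :
    IsCompact (realization K) := by
  have := Fintype.ofFinite W
  refine (isCompact_Icc (a := (0 : W → ℝ)) (b := 1)).of_isClosed_subset (isClosed_realization K) ?_
  intro x hx
  obtain ⟨h₁, h₂, -⟩ := mem_realization_iff.1 hx
  exact ⟨h₁, fun v => (Finset.single_le_sum (fun w _ => h₁ w) (Finset.mem_univ v)).trans_eq h₂⟩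

instance {W : Type u} [Finite W] (K : SComplex W) : CompactSpace (realization K) :=
  isCompact_iff_compactSpace.1 (isCompact_realization K)

open scoped Classical in
theorem vertex_mem_realization {W : Type u} {K : SComplex W} {v : W} (h : {v} ∈ K) :
    (Pi.single v 1 : W → ℝ) ∈ realization K := by
  refine ⟨{v}, h, fun w => ?_, fun w hw => ?_, by simp⟩
  · rw [Pi.single_apply]
    split_ifs <;> norm_num
  · rw [Finset.mem_singleton] at hw
    exact Pi.single_eq_of_ne hw 1

/-! ### Comparison of the contracted space with the collapsed cone -/

section Compare

variable {V : Type u}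

/-- A point of the base in the coordinates of the cone. -/
def extendZero (x : V → ℝ) : Option V → ℝ
  | none => 0
  | some v => x v

theorem extendZero_injective : Function.Injective (extendZero (V := V)) := fun _ _ h =>
  funext fun v => congrFun h (some v)

theorem continuous_extendZero : Continuous (extendZero (V := V)) :=
  continuous_pi fun v => by
    cases v with
    | none => exact continuous_const
    | some v => exact continuous_apply v

/-- The apex of the cone. -/
theorem exists_apex (X A : SComplex V) : ∃ z : realization (coneOff X A),
    (z : Option V → ℝ) none ≠ 0 ∧ (z : Option V → ℝ) ∈ realization (coneOff A A) := by
  classical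
  have h : ∀ X : SComplex V, ({none} : Finset (Option V)) ∈ coneOff X A := fun X =>
    Or.inr ⟨by simp, Or.inl (by ext; simp)⟩
  exact ⟨⟨_, vertex_mem_realization (h X)⟩, by simp, vertex_mem_realization (h A)⟩

variable [Finite V] {X A : SComplex V}

theorem extendZero_mem {x : V → ℝ} (hx : x ∈ realization X) :
    extendZero x ∈ realization (coneOff X A) := by
  classical
  have := Fintype.ofFinite V
  obtain ⟨h₁, h₂, s, hs, h₃⟩ := mem_realization_iff.1 hx
  refine mem_realization_iff.2 ⟨fun v => ?_, ?_, s.map .some, Or.inl ⟨by simp, ?_⟩, fun v hv => ?_⟩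
  · cases v with
    | none => exact le_rfl
    | some v => exact h₁ v
  · rw [Fintype.sum_option]
    simpa [extendZero] using h₂
  · rw [Finset.eraseNone_map_some]
    exact Or.inl hs
  · cases v with
    | none => rfl
    | some v => exact h₃ v fun h => hv (by simpa using h)

theorem exists_extendZero_eq (hA : A ≤ X) {z : Option V → ℝ}
    (hz : z ∈ realization (coneOff X A)) (h : z none = 0) :
    ∃ x ∈ realization X, extendZero x = z := by
  have := Fintype.ofFinite V
  obtain ⟨h₁, h₂, T, hT, h₃⟩ := mem_realization_iff.1 hz
  rw [Fintype.sum_option, h, zero_add] at h₂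
  refine ⟨fun v => z (some v), mem_realization_iff.2 ⟨fun v => h₁ _, h₂, Finset.eraseNone T, ?_,
    fun v hv => h₃ _ fun h => hv (Finset.mem_eraseNone.2 h)⟩, ?_⟩
  · rcases hT with ⟨_, h' | h'⟩ | ⟨_, h' | h'⟩
    · exact h'
    · exact hA h'
    · rw [Finset.sum_eq_zero fun v _ => h₃ _ fun hv => ?_] at h₂
      · exact absurd h₂ zero_ne_one
      · rw [← Finset.mem_eraseNone, h'] at hv
        exact absurd hv (Finset.notMem_empty v)
    · exact hA h'
  · ext v
    cases v with
    | none => exact h.symm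
    | some v => rfl

theorem extendZero_mem_iff {x : V → ℝ} :
    extendZero x ∈ realization (coneOff A A) ↔ x ∈ realization A := by
  refine ⟨fun h => ?_, extendZero_mem⟩
  obtain ⟨y, hy, hxy⟩ := exists_extendZero_eq le_rfl h rfl
  rwa [← extendZero_injective hxy]

/-- The inclusion of the base into the cone. -/
def baseInclusion (X A : SComplex V) : C(realization X, realization (coneOff X A)) where
  toFun x := ⟨extendZero x, extendZero_mem x.2⟩
  continuous_toFun := (continuous_extendZero.comp continuous_subtype_val).subtype_mk _

/-- The map from `|X| / |A|` to the quotient of `|X ∪ cone A|` by the cone. -/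
def toCollapse (X A : SComplex V) :
    TopCat.of (ContractedSpace X A) ⟶ TopCat.of (ContractedSpace (coneOff X A) (coneOff A A)) :=
  TopCat.ofHom
    ⟨Quotient.map' (baseInclusion X A) (by
      rintro x y (rfl | ⟨h, h'⟩)
      · exact Or.inl rfl
      · exact Or.inr ⟨extendZero_mem_iff.2 h, extendZero_mem_iff.2 h'⟩),
    Continuous.quotient_map' (baseInclusion X A).continuous _⟩

theorem toCollapse_injective : Function.Injective (toCollapse X A) := by
  intro x y h
  induction x using Quotient.inductionOn with | _ x
  induction y using Quotient.inductionOn with | _ y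
  rcases Quotient.exact h with h | ⟨h, h'⟩
  · exact congrArg _ (Subtype.ext (extendZero_injective (congrArg Subtype.val h)))
  · exact Quotient.sound (Or.inr ⟨extendZero_mem_iff.1 h, extendZero_mem_iff.1 h'⟩)

theorem toCollapse_contractedMap {X' A' : SComplex V} (hX : X ≤ X') (hA : A ≤ A')
    (x : ContractedSpace X A) :
    toCollapse X' A' (contractedMap hX hA x) =
      contractedMap (coneOff_mono hX hA) (coneOff_mono hA hA) (toCollapse X A x) := by
  induction x using Quotient.inductionOn with | _ x
  have h : baseInclusion X' A' (Set.inclusion (realization_mono hX) x) =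
      Set.inclusion (realization_mono (coneOff_mono hX hA)) (baseInclusion X A x) := rfl
  exact congrArg (contractProj (coneOff X' A') (coneOff A' A')) h

theorem isClosed_preimage_realization (X A : SComplex V) :
    IsClosed {z : realization X | (z : V → ℝ) ∈ realization A} :=
  (isClosed_realization A).preimage continuous_subtype_val

/-- Closedness is tested upstairs: the preimage of the image is a compact subset of the base,
together with the whole cone if the closed set meets the image of |A|. -/
theorem isClosedMap_toCollapse : IsClosedMap (toCollapse X A) := by
  intro F hF
  rw [← (isQuotientMap_contractProj _ _).isClosed_preimage]
  have hF' : IsClosed {x : realization X | contractProj X A x ∈ F} :=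
    hF.preimage (contractProj X A).hom.continuous
  have h : contractProj _ _ ⁻¹' (toCollapse X A '' F) =
      baseInclusion X A '' {x | contractProj X A x ∈ F} ∪
        {z | (z : Option V → ℝ) ∈ realization (coneOff A A) ∧
          ∃ x : realization X, (x : V → ℝ) ∈ realization A ∧ contractProj X A x ∈ F} := by
    ext z
    constructor
    · rintro ⟨y, hy, hyz⟩
      induction y using Quotient.inductionOn with | _ x
      rcases Quotient.exact hyz with h | ⟨h, h'⟩
      · exact Or.inl ⟨x, hy, h⟩
      · exact Or.inr ⟨h', x, extendZero_mem_iff.1 h, hy⟩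
    · rintro (⟨x, hx, rfl⟩ | ⟨hz, x, hx, hxF⟩)
      · exact ⟨_, hx, rfl⟩
      · exact ⟨_, hxF, Quotient.sound (Or.inr ⟨extendZero_mem_iff.2 hx, hz⟩)⟩
  rw [h]
  refine ((hF'.isCompact.image (baseInclusion X A).continuous).isClosed).union ?_
  by_cases hx : ∃ x : realization X, (x : V → ℝ) ∈ realization A ∧ contractProj X A x ∈ F
  · simpa only [hx, and_true] using isClosed_preimage_realization (coneOff X A) (coneOff A A)
  · simp only [hx, and_false, Set.ofPred_false, isClosed_empty]

/-- The cone over the empty complex is the apex. -/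
theorem mem_coneOff_self_iff (hA : ∀ s, s ∉ A) (z : realization (coneOff X A)) :
    (z : Option V → ℝ) ∈ realization (coneOff A A) ↔ (z : Option V → ℝ) none ≠ 0 := by
  have := Fintype.ofFinite V
  refine ⟨fun hz h => ?_, mem_coneOff_self_of_none_ne_zero z.2⟩
  obtain ⟨x, ⟨s, hs, -⟩, -⟩ := exists_extendZero_eq le_rfl hz h
  exact hA s hs

/-- The apex is open and closed if nothing is contracted. -/
theorem isClopen_none_ne_zero (hA : ∀ s, s ∉ A) :
    IsClopen {z : realization (coneOff X A) | (z : Option V → ℝ) none ≠ 0} := by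
  constructor
  · simp only [← mem_coneOff_self_iff hA]
    exact isClosed_preimage_realization _ _
  · exact isOpen_ne_fun ((continuous_apply none).comp continuous_subtype_val) continuous_const

/-- In positive degrees, contracting the base and collapsing the cone over it have the same
effect on homology. -/
theorem isIso_homologyMod2_map_toCollapse (hA : A ≤ X) {k : ℕ} (hk : k ≠ 0) :
    IsIso ((homologyMod2 k).map (toCollapse X A)) := by
  classical
  have := Fintype.ofFinite V
  obtain ⟨p, hp, hpA⟩ := exists_apex X A
  have hrange : ∀ z : realization (coneOff X A), (z : Option V → ℝ) ∉ realization (coneOff A A) →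
      contractProj _ _ z ∈ Set.range (toCollapse X A) := by
    intro z hz
    have : (z : Option V → ℝ) none = 0 := by
      by_contra h
      exact hz (mem_coneOff_self_of_none_ne_zero z.2 h)
    obtain ⟨x, hx, hxz⟩ := exists_extendZero_eq hA z.2 this
    exact ⟨contractProj X A ⟨x, hx⟩, congrArg (contractProj _ _) (Subtype.ext hxz)⟩
  -- If `A` has a vertex, that vertex hits the collapsed cone and the comparison is a homeomorphism.
  -- If `A` is empty, the cone is the apex alone, an isolated point outside the image.
  by_cases hne : ∃ s, s ∈ A
  · obtain ⟨s, hs⟩ := hne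
    obtain ⟨v, hv⟩ := nonempty_of_mem hs
    have hvA : {v} ∈ A := mem_of_subset hs (by simpa using hv) (Finset.singleton_nonempty v)
    have hsurj : Function.Surjective (toCollapse X A) := by
      intro y
      induction y using Quotient.inductionOn with | _ z
      by_cases hz : (z : Option V → ℝ) ∈ realization (coneOff A A)
      · exact ⟨contractProj X A ⟨_, vertex_mem_realization (hA hvA)⟩,
          Quotient.sound (Or.inr ⟨extendZero_mem_iff.2 (vertex_mem_realization hvA), hz⟩)⟩
      · exact hrange z hz
    have hhomeo : IsHomeomorph (toCollapse X A) :=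
      isHomeomorph_iff_continuous_isClosedMap_bijective.2
        ⟨(toCollapse X A).hom.continuous, isClosedMap_toCollapse, toCollapse_injective, hsurj⟩
    have : IsIso (toCollapse X A) := (TopCat.isoOfHomeo hhomeo.homeomorph).isIso_hom
    infer_instance
  · push Not at hne
    have hAe : ∀ x, x ∉ realization A := by
      rintro x ⟨s, hs, -⟩
      exact hne s hs
    have hAn := mem_coneOff_self_iff (X := X) hne
    have hpre : contractProj (coneOff X A) (coneOff A A) ⁻¹' {contractProj (coneOff X A) (coneOff A A) p} =
        {z : realization (coneOff X A) | (z : Option V → ℝ) ∈ realization (coneOff A A)} := by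
      ext z
      constructor
      · intro h
        rcases Quotient.exact h with h | ⟨h, -⟩
        · rw [h]; exact hpA
        · exact h
      · exact fun h => contractProj_eq h hpA
    have hr : Set.range (toCollapse X A) = {contractProj (coneOff X A) (coneOff A A) p}ᶜ := by
      ext y
      constructor
      · rintro ⟨x, rfl⟩ hx
        induction x using Quotient.inductionOn with | _ x
        have : baseInclusion X A x ∈
          contractProj (coneOff X A) (coneOff A A) ⁻¹' {contractProj (coneOff X A) (coneOff A A) p} := hx
        rw [hpre] at this
        exact hAe _ (extendZero_mem_iff.1 this)
      · intro hy
        induction y using Quotient.inductionOn with | _ z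
        exact hrange z fun hz => hy (contractProj_eq hz hpA)
    have hclosed : IsClosed {contractProj (coneOff X A) (coneOff A A) p} := by
      rw [← (isQuotientMap_contractProj _ _).isClosed_preimage, hpre]
      exact isClosed_preimage_realization _ _
    have hopen : IsOpen {contractProj (coneOff X A) (coneOff A A) p} := by
      rw [← (isQuotientMap_contractProj _ _).isOpen_preimage, hpre]
      simp only [hAn]
      exact (isClopen_none_ne_zero hne).isOpen
    refine isIso_homologyMod2_map_of_disjoint_point (toCollapse X A) ⟨?_, ?_⟩ _ hopen hr hk
    · exact (Topology.IsClosedEmbedding.of_continuous_injective_isClosedMap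
        (toCollapse X A).hom.continuous toCollapse_injective isClosedMap_toCollapse).isEmbedding
    · rw [hr]
      exact hclosed.isOpen_compl

end Compare

/-! ### Invariance of persistence diagrams -/

theorem IsPersistenceDiagram.of_iso {M N : ℕ ⥤ ModuleCat.{u} (ZMod 2)} (φ : M ≅ N)
    {D : Multiset (ℕ × ℕ∞)} (h : IsPersistenceDiagram M D) : IsPersistenceDiagram N D := by
  obtain ⟨n, b, d, e, hbd, hD, hbasis, hmap⟩ := h
  let E : ∀ t, M.obj t ≃ₗ[ZMod 2] N.obj t := fun t => (φ.app t).toLinearEquiv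
  refine ⟨n, b, d, fun t i => E t (e t i), hbd, hD, fun t => ⟨?_, ?_⟩, fun t i hb hd => ?_⟩
  · exact (hbasis t).1.map' (E t).toLinearMap (E t).ker
  · have := congrArg (Submodule.map (E t).toLinearMap) (hbasis t).2
    rw [Submodule.map_span, Submodule.map_top, LinearEquiv.range, ← Set.range_comp] at this
    exact this
  · have hnat : ∀ x, (N.map (homOfLE (Nat.le_succ t))).hom (E t x) =
        E (t + 1) ((M.map (homOfLE (Nat.le_succ t))).hom x) := fun x =>
      congr($(φ.hom.naturality (homOfLE (Nat.le_succ t))).hom x).symm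
    obtain ⟨h₁, h₂⟩ := hmap t i hb hd
    refine ⟨fun h => ?_, fun h => ?_⟩
    · rw [hnat, h₁ h]
    · rw [hnat, h₂ h, map_zero]

theorem isPersistenceDiagram_congr {M N : ℕ ⥤ ModuleCat.{u} (ZMod 2)} (φ : M ≅ N)
    (D : Multiset (ℕ × ℕ∞)) : IsPersistenceDiagram M D ↔ IsPersistenceDiagram N D :=
  ⟨.of_iso φ, .of_iso φ.symm⟩

/-- The cones over the contracted parts. -/
def contractedCone {V : Type u} (S : List (Step V)) : ℕ →o SComplex (Option V) where
  toFun t := coneOff (contracted S t) (contracted S t)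
  monotone' _ _ h := coneOff_mono ((contracted S).monotone h) ((contracted S).monotone h)

/-- The projections onto the quotients by the cones. -/
def collapseCone {V : Type u} (S : List (Step V)) :
    coneSequence S ⟶ contractedSequence (coneFiltration S) (contractedCone S) where
  app t := contractProj (coneFiltration S t) (contractedCone S t)
  naturality _ _ _ := rfl

/-- The comparison of the contracted spaces with the collapsed cones. -/
def quotientToCollapse {V : Type u} [Finite V] (S : List (Step V)) :
    quotientSequence S ⟶ contractedSequence (coneFiltration S) (contractedCone S) where
  app t := toCollapse (spawned S t) (contracted S t)
  naturality s t h := by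
    ext x
    exact toCollapse_contractedMap ((spawned S).monotone (leOfHom h))
      ((contracted S).monotone (leOfHom h)) x

/-- In positive degrees, the simplicial quotient method gives the same persistent homology. -/
theorem isPersistenceDiagram_coneSequence_iff {V : Type u} [Finite V] {S : List (Step V)}
    (hS : ∀ t, contracted S t ≤ spawned S t) {k : ℕ} (hk : k ≠ 0) (D : Multiset (ℕ × ℕ∞)) :
    IsPersistenceDiagram (persistentHomology k (coneSequence S)) D ↔
      IsPersistenceDiagram (persistentHomology k (quotientSequence S)) D := by
  have := Fintype.ofFinite V
  have h₁ : IsIso (Functor.whiskerRight (collapseCone S) (homologyMod2 k)) := by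
    rw [NatTrans.isIso_iff_isIso_app]
    exact fun t => isIso_homologyMod2_map_collapseCone (hS t) k
  have h₂ : IsIso (Functor.whiskerRight (quotientToCollapse S) (homologyMod2 k)) := by
    rw [NatTrans.isIso_iff_isIso_app]
    exact fun t => isIso_homologyMod2_map_toCollapse (hS t) hk
  exact isPersistenceDiagram_congr
    (asIso (Functor.whiskerRight (collapseCone S) (homologyMod2 k)) ≪≫
      (asIso (Functor.whiskerRight (quotientToCollapse S) (homologyMod2 k))).symm) D

/-! ### Components of contracted spaces -/

section Components

variable {V : Type u}

open scoped Classical in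
/-- The equivalence relation on vertices generated by the edges of `X` and by the identification
of the vertices of `A`. -/
def linkedSetoid (X A : SComplex V) : Setoid V :=
  Relation.EqvGen.setoid fun u v => ({u, v} : Finset V) ∈ X ∨ ({u} ∈ A ∧ {v} ∈ A)

open scoped Classical in
theorem linkedSetoid_le_iff {X A : SComplex V} {r : Setoid V} :
    linkedSetoid X A ≤ r ↔ (∀ u v, ({u, v} : Finset V) ∈ X → r u v) ∧
      ∀ u v, {u} ∈ A → {v} ∈ A → r u v := by
  constructor
  · intro h
    exact ⟨fun u v huv => h (Relation.EqvGen.rel _ _ (Or.inl huv)),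
      fun u v hu hv => h (Relation.EqvGen.rel _ _ (Or.inr ⟨hu, hv⟩))⟩
  · rintro ⟨h₁, h₂⟩ u v huv
    induction huv with
    | rel u v h => exact h.elim (h₁ u v) fun h => h₂ u v h.1 h.2
    | refl u => exact r.refl u
    | symm u v _ h => exact r.symm h
    | trans u v w _ _ h h' => exact r.trans h h'

theorem linkedSetoid_mono {X X' A A' : SComplex V} (hX : X ≤ X') (hA : A ≤ A') :
    linkedSetoid X A ≤ linkedSetoid X' A' :=
  linkedSetoid_le_iff.2 ⟨fun _ _ h => Relation.EqvGen.rel _ _ (Or.inl (hX h)),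
    fun _ _ h h' => Relation.EqvGen.rel _ _ (Or.inr ⟨hA h, hA h'⟩)⟩

open scoped Classical in
/-- A vertex as a point of the realization. -/
noncomputable def vertexPoint {X : SComplex V} {v : V} (h : {v} ∈ X) : realization X :=
  ⟨Pi.single v 1, vertex_mem_realization h⟩

theorem vertexPoint_ne {X : SComplex V} {v w : V} (h : {v} ∈ X) (hw : w ≠ v) :
    (vertexPoint h : V → ℝ) w = 0 := by
  classical
  exact Pi.single_eq_of_ne hw 1

theorem joined_of_common_face [Finite V] {X : SComplex V} {x y : realization X} {s : Finset V}
    (hs : s ∈ X) (hx : ∀ v, v ∉ s → (x : V → ℝ) v = 0) (hy : ∀ v, v ∉ s → (y : V → ℝ) v = 0) :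
    Joined x y := by
  have := Fintype.ofFinite V
  exact ⟨(straightLine (Y := PUnit) (.const _ x) (.const _ y)
    fun _ => ⟨s, hs, fun v hv => ⟨hx v hv, hy v hv⟩⟩).evalAt PUnit.unit⟩

theorem exists_joined_vertexPoint [Finite V] {X : SComplex V} (x : realization X) :
    ∃ (v : V) (h : {v} ∈ X), Joined x (vertexPoint h) := by
  obtain ⟨s, hs, _, hx, -⟩ := x.2
  obtain ⟨v, hv⟩ := nonempty_of_mem hs
  have hvX : {v} ∈ X := mem_of_subset hs (by simpa using hv) (Finset.singleton_nonempty v)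
  exact ⟨v, hvX, joined_of_common_face hs hx fun w hw =>
    vertexPoint_ne _ fun h => hw (h ▸ hv)⟩

/-- A vertex of the smallest face that contains a point. -/
theorem exists_ne_zero {X : SComplex V} (x : realization X) : ∃ v, (x : V → ℝ) v ≠ 0 := by
  obtain ⟨s, _, _, _, hx⟩ := x.2
  by_contra! h
  rw [Finset.sum_eq_zero fun v _ => h v] at hx
  exact zero_ne_one hx

/-- The component of a point, as a class of vertices. -/
noncomputable def componentMap (X A : SComplex V) (x : realization X) :
    Quotient (linkedSetoid X A) := Quotient.mk _ (exists_ne_zero x).choose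

/-- Any two vertices in the support of a point lie in a common face, so they are equal or joined by
an edge. The choice of vertex in the definition is therefore immaterial. -/
theorem componentMap_eq {X A : SComplex V} {x : realization X} {v : V}
    (hv : (x : V → ℝ) v ≠ 0) : componentMap X A x = Quotient.mk _ v := by
  classical
  obtain ⟨s, hs, _, hx, -⟩ := x.2
  have hmem : ∀ w, (x : V → ℝ) w ≠ 0 → w ∈ s := fun w hw => by
    by_contra h
    exact hw (hx w h)
  refine Quotient.sound (Relation.EqvGen.rel _ _ (Or.inl (mem_of_subset hs ?_ (by simp))))
  intro w hw
  rcases Finset.mem_insert.1 hw with rfl | hw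
  · exact hmem _ (exists_ne_zero x).choose_spec
  · rw [Finset.mem_singleton.1 hw]
    exact hmem v hv

/-- If the coordinate of `v` is non-zero at a point, it is non-zero nearby, and `v` names the class
on that neighbourhood. -/
theorem isLocallyConstant_componentMap (X A : SComplex V) :
    IsLocallyConstant (componentMap X A) := by
  rw [IsLocallyConstant.iff_exists_open]
  intro x
  obtain ⟨v, hv⟩ := exists_ne_zero x
  refine ⟨{y | (y : V → ℝ) v ≠ 0}, isOpen_ne_fun
    ((continuous_apply v).comp continuous_subtype_val) continuous_const, hv, fun y hy => ?_⟩
  rw [componentMap_eq hv, componentMap_eq hy]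

/-- Vertices joined by a path in the contracted space are linked. -/
theorem linked_of_joined {X A : SComplex V} {u v : V} (hu : {u} ∈ X) (hv : {v} ∈ X)
    (h : Joined (contractProj X A (vertexPoint hu)) (contractProj X A (vertexPoint hv))) :
    linkedSetoid X A u v := by
  classical
  let t : TopologicalSpace (Quotient (linkedSetoid X A)) := ⊥
  have : DiscreteTopology (Quotient (linkedSetoid X A)) := ⟨rfl⟩
  have hmem : ∀ x : realization X, (x : V → ℝ) ∈ realization A → ∀ w, (x : V → ℝ) w ≠ 0 →
      {w} ∈ A := by
    rintro x ⟨s, hs, _, hx, -⟩ w hw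
    have hws : w ∈ s := by
      by_contra h
      exact hw (hx w h)
    exact mem_of_subset hs (by simpa using hws) (Finset.singleton_nonempty w)
  -- All support vertices of points of |A| are linked, so the component map descends to the
  -- contracted space. With a discrete target it is constant along paths.
  let c : ContractedSpace X A → Quotient (linkedSetoid X A) :=
    Quotient.lift (componentMap X A) (by
      rintro x y (rfl | ⟨hx, hy⟩)
      · rfl
      · obtain ⟨w, hw⟩ := exists_ne_zero x
        obtain ⟨w', hw'⟩ := exists_ne_zero y
        rw [componentMap_eq hw, componentMap_eq hw']
        exact Quotient.sound (Relation.EqvGen.rel _ _ (Or.inr ⟨hmem x hx w hw, hmem y hy w' hw'⟩)))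
  have hc : Continuous c := (isLocallyConstant_componentMap X A).continuous.quotient_lift _
  obtain ⟨γ⟩ := h
  have key : c (γ 0) = c (γ 1) :=
    PreconnectedSpace.constant inferInstance (hc.comp γ.continuous)
  rw [γ.source, γ.target] at key
  have hval : ∀ (w : V) (hw : {w} ∈ X), c (contractProj X A (vertexPoint hw)) = Quotient.mk _ w :=
    fun w hw => componentMap_eq (by simp [vertexPoint])
  rw [hval, hval] at key
  exact Quotient.exact key

open scoped Classical in
/-- The degree-zero homology class of a vertex in the contracted space. -/
noncomputable def contractedClass (X A : SComplex V) (v : V) :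
    (homologyMod2 0).obj (TopCat.of (ContractedSpace X A)) :=
  -- The value for absent vertices is harmless: for `A ≤ X` such a vertex is linked to no other one.
  if h : {v} ∈ X then pointClass _ (contractProj X A (vertexPoint h)) else 0

theorem contractedClass_eq_of_linked [Finite V] {X A : SComplex V} (hA : A ≤ X) {u v : V}
    (h : linkedSetoid X A u v) : contractedClass X A u = contractedClass X A v := by
  classical
  have hle : linkedSetoid X A ≤ Setoid.ker (contractedClass X A) := by
    rw [linkedSetoid_le_iff]
    constructor
    · intro u v huv
      have hu : {u} ∈ X := mem_of_subset huv (by simp) (by simp)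
      have hv : {v} ∈ X := mem_of_subset huv (by simp) (by simp)
      rw [Setoid.ker_def, contractedClass, contractedClass, dif_pos hu, dif_pos hv]
      refine pointClass_eq_of_joined (Joined.map ?_ (contractProj X A).hom.continuous)
      exact joined_of_common_face huv (fun w hw => vertexPoint_ne _ (by rintro rfl; simp at hw))
        (fun w hw => vertexPoint_ne _ (by rintro rfl; simp at hw))
    · intro u v hu hv
      have hu' : {u} ∈ X := hA hu
      have hv' : {v} ∈ X := hA hv
      rw [Setoid.ker_def, contractedClass, contractedClass, dif_pos hu', dif_pos hv']
      exact congrArg _ (contractProj_eq (vertex_mem_realization hu) (vertex_mem_realization hv))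
  exact hle h

theorem map_contractedClass {X X' A A' : SComplex V} (hX : X ≤ X') (hA : A ≤ A') {v : V}
    (hv : {v} ∈ X) :
    ((homologyMod2 0).map (TopCat.ofHom (contractedMap hX hA))).hom (contractedClass X A v) =
      contractedClass X' A' v := by
  have hv' : {v} ∈ X' := hX hv
  rw [contractedClass, contractedClass, dif_pos hv, dif_pos hv']
  exact map_pointClass _ _

/-- Representatives of the components give a basis of the homology in degree zero. -/
theorem exists_basis_contractedClass [Finite V] {X A : SComplex V} (hA : A ≤ X) {R : Set V}
    (hR : ∀ v ∈ R, {v} ∈ X) (hex : ∀ u, {u} ∈ X → ∃ v ∈ R, linkedSetoid X A u v)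
    (huniq : ∀ u ∈ R, ∀ v ∈ R, linkedSetoid X A u v → u = v) :
    ∃ b : Module.Basis R (ZMod 2) ((homologyMod2 0).obj (TopCat.of (ContractedSpace X A))),
      ∀ v : R, b v = contractedClass X A v := by
  let Y := TopCat.of (ContractedSpace X A)
  obtain ⟨b, hb⟩ := exists_basis_pointClass Y
  have hcls : ∀ (v : V) (hv : {v} ∈ X), contractedClass X A v =
      pointClass Y (contractProj X A (vertexPoint hv)) := fun v hv => dif_pos hv
  let m : R → ZerothHomotopy Y := fun v => .mk (contractProj X A (vertexPoint (hR v v.2)))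
  have hm : Function.Bijective m := by
    constructor
    · intro u v huv
      exact Subtype.ext (huniq u u.2 v v.2 (linked_of_joined _ _ (Quotient.exact huv)))
    · intro y
      induction y with | _ y
      induction y using Quotient.inductionOn with | _ x
      obtain ⟨u, hu, hxu⟩ := exists_joined_vertexPoint x
      obtain ⟨v, hv, huv⟩ := hex u hu
      refine ⟨⟨v, hv⟩, b.injective ?_⟩
      rw [hb, hb, ← hcls v, ← contractedClass_eq_of_linked hA huv, hcls u hu]
      exact (pointClass_eq_of_joined (hxu.map (contractProj X A).hom.continuous)).symm
  refine ⟨b.reindex (Equiv.ofBijective m hm).symm, fun v => ?_⟩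
  rw [Module.Basis.reindex_apply, hcls v (hR v v.2), ← hb]
  rfl

end Components

/-! ### Persistence diagrams in degree zero -/

section DegreeZero

variable {V : Type u} [Finite V] {X A : ℕ →o SComplex V}

/-- The vertices alive at time `t`, that is present and not dead, represent the components. -/
structure AliveRepresent (X A : SComplex V) (death : V → ℕ∞) (t : ℕ) : Prop where
  exists_linked : ∀ u, {u} ∈ X → ∃ v, {v} ∈ X ∧ (t : ℕ∞) < death v ∧ linkedSetoid X A u v
  eq_of_linked : ∀ u v, {u} ∈ X → {v} ∈ X → (t : ℕ∞) < death u → (t : ℕ∞) < death v →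
    linkedSetoid X A u v → u = v

/-- The feature of a vertex: its class, minus the class of its heir if the vertex dies. -/
noncomputable def feature (X A : SComplex V) (death : V → ℕ∞) (heir : V → V) (v : V) :
    (homologyMod2 0).obj (TopCat.of (ContractedSpace X A)) :=
  open scoped Classical in
  contractedClass X A v - if death v = ⊤ then 0 else contractedClass X A (heir v)

theorem feature_eq_zero {X A : SComplex V} (hA : A ≤ X) {death : V → ℕ∞} {heir : V → V} {v : V}
    (h : death v ≠ ⊤) (hv : linkedSetoid X A v (heir v)) : feature X A death heir v = 0 := by
  rw [feature, if_neg h, sub_eq_zero]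
  exact contractedClass_eq_of_linked hA hv

/-- The change from classes to features is triangular for the order given by `tick`, since heirs
have larger ticks. Induction from the largest tick downwards recovers each class as a feature plus
the class of the heir, so the features span. -/
theorem basis_feature {X A : SComplex V} (hA : A ≤ X) {death : V → ℕ∞} {heir : V → V}
    {tick : V → ℕ∞} {t : ℕ} (h : AliveRepresent X A death t)
    (hheir : ∀ v, {v} ∈ X → (t : ℕ∞) < death v → death v ≠ ⊤ →
      {heir v} ∈ X ∧ (t : ℕ∞) < death (heir v) ∧ tick v < tick (heir v)) :
    LinearIndependent (ZMod 2)
      (fun v : {v | {v} ∈ X ∧ (t : ℕ∞) < death v} => feature X A death heir v) ∧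
    Submodule.span (ZMod 2)
      (Set.range fun v : {v | {v} ∈ X ∧ (t : ℕ∞) < death v} => feature X A death heir v) = ⊤ := by
  classical
  obtain ⟨b, hb⟩ := exists_basis_contractedClass hA (R := {v | {v} ∈ X ∧ (t : ℕ∞) < death v})
    (fun v hv => hv.1)
    (fun u hu => by
      obtain ⟨v, hv, hv', huv⟩ := h.exists_linked u hu
      exact ⟨v, ⟨hv, hv'⟩, huv⟩)
    (fun u hu v hv => h.eq_of_linked u v hu.1 hv.1 hu.2 hv.2)
  have := Fintype.ofFinite {v | {v} ∈ X ∧ (t : ℕ∞) < death v}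
  have hwf : WellFounded fun v w : V => tick w < tick v :=
    (Finite.to_wellFoundedGT (α := Set.range tick)).wf.onFun
      (f := fun v => (⟨tick v, v, rfl⟩ : Set.range tick))
  have hmem : ∀ v, {v} ∈ X → (t : ℕ∞) < death v → contractedClass X A v ∈
      Submodule.span (ZMod 2) (Set.range fun v : {v | {v} ∈ X ∧ (t : ℕ∞) < death v} =>
        feature X A death heir v) := by
    intro v
    induction v using hwf.induction with
    | _ v ih =>
      intro hv hd
      have hf : feature X A death heir v ∈ Submodule.span (ZMod 2)
          (Set.range fun v : {v | {v} ∈ X ∧ (t : ℕ∞) < death v} => feature X A death heir v) :=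
        Submodule.subset_span ⟨⟨v, hv, hd⟩, rfl⟩
      by_cases htop : death v = ⊤
      · rwa [feature, if_pos htop, sub_zero] at hf
      · obtain ⟨h₁, h₂, h₃⟩ := hheir v hv hd htop
        have := Submodule.add_mem _ hf (ih _ h₃ h₁ h₂)
        rwa [feature, if_neg htop, sub_add_cancel] at this
  have hspan : Submodule.span (ZMod 2) (Set.range fun v : {v | {v} ∈ X ∧ (t : ℕ∞) < death v} =>
      feature X A death heir v) = ⊤ := by
    rw [← top_le_iff, ← b.span_eq, Submodule.span_le]
    rintro _ ⟨v, rfl⟩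
    rw [hb]
    exact hmem v v.2.1 v.2.2
  -- There are as many features as basis vectors, so a spanning family is independent.
  exact ⟨linearIndependent_of_top_le_span_of_card_eq_finrank hspan.ge
    (Module.finrank_eq_card_basis b).symm, hspan⟩

open scoped Classical in
/-- The elder rule: a persistence diagram from the births and deaths of vertices. -/
theorem isPersistenceDiagram_of_elder_rule [Fintype V] (hA : ∀ t, A t ≤ X t) {P : V → Prop}
    {birth : V → ℕ} {death : V → ℕ∞} {heir : V → V} {tick : V → ℕ∞}
    (hP : ∀ t v, {v} ∈ X t ↔ P v ∧ birth v ≤ t)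
    (halive : ∀ t, AliveRepresent (X t) (A t) death t)
    (hheir : ∀ v (d : ℕ), P v → death v = d → P (heir v) ∧ birth (heir v) ≤ birth v ∧
      death v ≤ death (heir v) ∧ tick v < tick (heir v) ∧ linkedSetoid (X d) (A d) v (heir v)) :
    IsPersistenceDiagram (persistentHomology 0 (contractedSequence X A))
      ((Finset.univ.filter fun v => P v ∧ (birth v : ℕ∞) < death v).val.map
        fun v => (birth v, death v)) := by
  have hheir' : ∀ t v, {v} ∈ X t → (t : ℕ∞) < death v → death v ≠ ⊤ →
      {heir v} ∈ X t ∧ (t : ℕ∞) < death (heir v) ∧ tick v < tick (heir v) := by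
    intro t v hv ht hd
    obtain ⟨d, hd⟩ := ENat.ne_top_iff_exists.1 hd
    obtain ⟨hPv, hbv⟩ := (hP t v).1 hv
    obtain ⟨h₁, h₂, h₃, h₄, -⟩ := hheir v d hPv hd.symm
    exact ⟨(hP t _).2 ⟨h₁, h₂.trans hbv⟩, ht.trans_le h₃, h₄⟩
  let I := {v // P v ∧ (birth v : ℕ∞) < death v}
  let ε : Fin (Fintype.card I) ≃ I := (Fintype.equivFin I).symm
  refine ⟨Fintype.card I, fun i => birth (ε i), fun i => death (ε i),
    fun t i => feature (X t) (A t) death heir (ε i), fun i => (ε i).2.2, ?_, fun t => ?_,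
    fun t i hb hd => ?_⟩
  · have h₁ : (Finset.univ : Finset (Fin (Fintype.card I))).val.map ε =
        (Finset.univ : Finset I).val := by
      exact congrArg Finset.val (Finset.map_univ_equiv ε)
    have h₂ : (Finset.univ : Finset I).val.map Subtype.val =
        (Finset.univ.filter fun v => P v ∧ (birth v : ℕ∞) < death v).val := by
      have : (Finset.univ : Finset I).map (Function.Embedding.subtype _) =
          Finset.univ.filter fun v => P v ∧ (birth v : ℕ∞) < death v := by
        ext v
        simp [I]
      exact congrArg Finset.val this
    rw [← h₂, ← h₁, Multiset.map_map, Multiset.map_map]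
    rfl
  · let j : {i // birth (ε i) ≤ t ∧ (t : ℕ∞) < death (ε i)} ≃
        {v | {v} ∈ X t ∧ (t : ℕ∞) < death v} :=
      { toFun := fun i => ⟨ε i, (hP t _).2 ⟨(ε i).2.1, i.2.1⟩, i.2.2⟩
        invFun := fun v => ⟨ε.symm ⟨v, ((hP t _).1 v.2.1).1,
          (Nat.cast_le.2 ((hP t _).1 v.2.1).2).trans_lt v.2.2⟩, by
            simpa using ⟨((hP t _).1 v.2.1).2, v.2.2⟩⟩
        left_inv := fun i => by simp
        right_inv := fun v => by simp }
    obtain ⟨h₁, h₂⟩ := basis_feature (tick := tick) (hA t) (halive t) (hheir' t)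
    constructor
    · exact h₁.comp j j.injective
    · have hr := j.surjective.range_comp
        fun v : {v | {v} ∈ X t ∧ (t : ℕ∞) < death v} => feature (X t) (A t) death heir v
      rw [← hr] at h₂
      exact h₂
  · have hv : {(ε i : V)} ∈ X t := (hP t _).2 ⟨(ε i).2.1, hb⟩
    have hle : t ≤ t + 1 := Nat.le_succ t
    have hmap : ∀ v, {v} ∈ X t → ((homologyMod2 0).map ((contractedSequence X A).map
        (homOfLE (Nat.le_succ t)))).hom (contractedClass (X t) (A t) v) =
          contractedClass (X (t + 1)) (A (t + 1)) v := fun v hv =>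
      map_contractedClass (X.monotone hle) (A.monotone hle) hv
    -- The heir of a living vertex is present too, so both terms of the feature are carried along.
    -- If `t + 1` is the death of the vertex, it is then linked to its heir and the feature
    -- vanishes.
    have hfeat : ((homologyMod2 0).map ((contractedSequence X A).map
        (homOfLE (Nat.le_succ t)))).hom (feature (X t) (A t) death heir (ε i)) =
          feature (X (t + 1)) (A (t + 1)) death heir (ε i) := by
      rw [feature, feature]
      erw [map_sub]
      rw [hmap _ hv]
      congr 1
      split_ifs with htop
      · exact map_zero _
      · exact hmap _ (hheir' t _ hv hd htop).1
    refine ⟨fun _ => hfeat, fun hd' => hfeat.trans ?_⟩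
    have hd'' : death (ε i) = (t + 1 : ℕ) := hd'.symm
    exact feature_eq_zero (hA _) (hd'' ▸ ENat.natCast_ne_top _)
      (hheir _ _ (ε i).2.1 hd'').2.2.2.2

end DegreeZero

/-! ### Correctness of the tracking procedure -/

section Tracking

variable {V : Type u}

/-- The linked vertices at time `t`. -/
abbrev linkedAt (S : List (Step V)) (t : ℕ) : Setoid V :=
  linkedSetoid (spawned S t) (contracted S t)

open scoped Classical in
/-- The state of the tracking procedure during step `i`, when the vertices of `P` have been
spawned, records correct deaths; `heir v` is the representative in favour of which `v` was killed,
and `tick` is the order in which the representatives were killed. -/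
structure Tracks [Fintype V] (S : List (Step V)) (i : ℕ) (P : V → Prop) (T : Tracker V)
    (death : V → ℕ∞) (heir : V → V) (tick : V → ℕ∞) : Prop where
  rep_mem : ∀ v, P v → P (T.rep v)
  rep_rep : ∀ v, P v → T.rep (T.rep v) = T.rep v
  linked_rep : ∀ v, P v → linkedAt S i v (T.rep v)
  birth_le : ∀ v, P v → T.birth v ≤ i
  spawned_iff : ∀ v, P v → ∀ t ≤ i, {v} ∈ spawned S t ↔ T.birth v ≤ t
  death_top : ∀ v, P v → (death v = ⊤ ↔ T.rep v = v)
  tick_top : ∀ v, P v → (tick v = ⊤ ↔ T.rep v = v)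
  absent : ∀ v, ¬ P v → death v = ⊤ ∧ tick v = ⊤
  death_le : ∀ v (d : ℕ), death v = d → d ≤ i
  dead_eq : T.dead = (Finset.univ.filter fun v => death v ≠ ⊤ ∧ (T.birth v : ℕ∞) < death v).val.map
    fun v => (T.birth v, death v)
  heir_spec : ∀ v (d : ℕ), death v = d → P (heir v) ∧ T.birth (heir v) ≤ T.birth v ∧
    death v ≤ death (heir v) ∧ tick v < tick (heir v) ∧ linkedAt S d v (heir v)
  history : ∀ t < i, AliveRepresent (spawned S t) (contracted S t) death t

/-- The state of the tracking procedure during step `i` is correct. -/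
def IsTracking [Fintype V] (S : List (Step V)) (i : ℕ) (P : V → Prop) (T : Tracker V) : Prop :=
  ∃ death heir tick, Tracks S i P T death heir tick

theorem AliveRepresent.congr {X A : SComplex V} {death death' : V → ℕ∞} {t : ℕ}
    (h : AliveRepresent X A death t)
    (hd : ∀ v, (t : ℕ∞) < death' v ↔ (t : ℕ∞) < death v) : AliveRepresent X A death' t where
  exists_linked u hu := by
    obtain ⟨v, hv, hv', huv⟩ := h.exists_linked u hu
    exact ⟨v, hv, (hd v).2 hv', huv⟩
  eq_of_linked u v hu hv hu' hv' := h.eq_of_linked u v hu hv ((hd u).1 hu') ((hd v).1 hv')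

/-- The killed vertex gets death `i` and heir `w`, which is at least as old and still alive. Earlier
alive sets do not change, because the death only drops from ⊤ to `i` and the history concerns times
before `i`. -/
theorem isTracking_kill [Fintype V] {S : List (Step V)} {i : ℕ} {P : V → Prop} {T : Tracker V}
    (h : IsTracking S i P T) {w l : V} (hw : P w) (hl : P l) (hrw : T.rep w = w)
    (hrl : T.rep l = l) (hne : w ≠ l) (hb : T.birth w ≤ T.birth l) (hlink : linkedAt S i l w) :
    IsTracking S i P (T.kill i w l) := by
  classical
  obtain ⟨death, heir, tick, h⟩ := h
  -- The new tick must exceed those of all vertices killed so far, some of which may have `l` as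
  -- heir, and stay below ⊤, the tick of the survivor `w`. Deaths could not play this role, since
  -- many vertices may die in the same step.
  obtain ⟨N, hN⟩ : ∃ N : ℕ, ∀ v, tick v ≠ ⊤ → tick v < N := by
    refine ⟨∑ v, (tick v).toNat + 1, fun v hv => ?_⟩
    have := Finset.single_le_sum (f := fun v => (tick v).toNat) (fun _ _ => Nat.zero_le _)
      (Finset.mem_univ v)
    rw [← ENat.natCast_toNat hv]
    exact_mod_cast Nat.lt_succ_of_le this
  have hdl : death l = ⊤ := (h.death_top l hl).2 hrl
  have hdw : death w = ⊤ := (h.death_top w hw).2 hrw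
  have htw : tick w = ⊤ := (h.tick_top w hw).2 hrw
  have hrep : ∀ x, (T.kill i w l).rep x = if T.rep x = l then w else T.rep x := fun x => rfl
  have hbirth : (T.kill i w l).birth = T.birth := rfl
  have hrep_iff : ∀ v, P v → ((T.kill i w l).rep v = v ↔ T.rep v = v ∧ v ≠ l) := by
    intro v hv
    rw [hrep]
    split_ifs with hvl
    · constructor
      · rintro rfl
        exact absurd (hrw.symm.trans hvl) hne
      · rintro ⟨h₁, h₂⟩
        exact absurd (h₁.symm.trans hvl) h₂
    · constructor
      · intro h₁
        exact ⟨h₁, fun h₂ => hvl (by rw [h₂, hrl])⟩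
      · exact fun h₁ => h₁.1
  refine ⟨Function.update death l i, Function.update heir l w, Function.update tick l N, ?_⟩
  constructor
  · intro v hv
    rw [hrep]
    split_ifs
    · exact hw
    · exact h.rep_mem v hv
  · intro v hv
    rw [hrep v]
    split_ifs with hvl
    · rw [hrep, hrw, if_neg hne]
    · rw [hrep, h.rep_rep v hv, if_neg hvl]
  · intro v hv
    rw [hrep]
    have := h.linked_rep v hv
    split_ifs with hvl
    · rw [hvl] at this
      exact Setoid.trans' _ this hlink
    · exact this
  · exact h.birth_le
  · exact h.spawned_iff
  · intro v hv
    rw [hrep_iff v hv, ← h.death_top v hv]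
    by_cases hvl : v = l
    · subst hvl
      simp
    · rw [Function.update_of_ne hvl]
      simp [hvl]
  · intro v hv
    rw [hrep_iff v hv, ← h.tick_top v hv]
    by_cases hvl : v = l
    · subst hvl
      simp
    · rw [Function.update_of_ne hvl]
      simp [hvl]
  · intro v hv
    have hvl : v ≠ l := fun h => hv (h ▸ hl)
    rw [Function.update_of_ne hvl, Function.update_of_ne hvl]
    exact h.absent v hv
  · intro v d hd
    by_cases hvl : v = l
    · subst hvl
      rw [Function.update_self] at hd
      exact (Nat.cast_injective hd).ge
    · rw [Function.update_of_ne hvl] at hd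
      exact h.death_le v d hd
  · have hfilter : (Finset.univ.filter fun v => Function.update death l (i : ℕ∞) v ≠ ⊤ ∧
        (T.birth v : ℕ∞) < Function.update death l (i : ℕ∞) v) =
        (if T.birth l < i then {l} else ∅) ∪
          Finset.univ.filter fun v => death v ≠ ⊤ ∧ (T.birth v : ℕ∞) < death v := by
      ext v
      by_cases hvl : v = l
      · subst hvl
        by_cases hb : T.birth v < i <;> simp [hb, hdl]
      · by_cases hb : T.birth l < i <;> simp [hb, hvl]
    have hmap : ∀ v ∈ (Finset.univ.filter fun v => death v ≠ ⊤ ∧ (T.birth v : ℕ∞) < death v).val,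
        (T.birth v, death v) = (T.birth v, Function.update death l (i : ℕ∞) v) := by
      intro v hv
      have hvl : v ≠ l := by
        rintro rfl
        simp [hdl] at hv
      rw [Function.update_of_ne hvl]
    change (if T.birth l < i then (T.birth l, (i : ℕ∞)) ::ₘ T.dead else T.dead) = _
    rw [hbirth, hfilter, h.dead_eq, Multiset.map_congr rfl hmap]
    by_cases hb : T.birth l < i
    · rw [if_pos hb, if_pos hb, ← Finset.insert_eq, Finset.insert_val_of_notMem (by simp [hdl]),
        Multiset.map_cons, Function.update_self]
    · rw [if_neg hb, if_neg hb, Finset.empty_union]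
  · intro v d hd
    rw [hbirth]
    by_cases hvl : v = l
    · subst hvl
      rw [Function.update_self] at hd
      rw [Function.update_self, Function.update_self, Function.update_self,
        Function.update_of_ne hne, Function.update_of_ne hne, hdw, htw, ← Nat.cast_injective hd]
      exact ⟨hw, hb, le_top, ENat.natCast_lt_top N, hlink⟩
    · rw [Function.update_of_ne hvl] at hd
      obtain ⟨h₁, h₂, h₃, h₄, h₅⟩ := h.heir_spec v d hd
      rw [Function.update_of_ne hvl, Function.update_of_ne hvl, Function.update_of_ne hvl]
      refine ⟨h₁, h₂, ?_, ?_, h₅⟩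
      -- If the heir of `v` is the vertex now killed, its death drops to `i`, which is still no
      -- earlier than the death of `v`; its tick drops to `N`, which is still larger than that of
      -- `v`.
      · by_cases hhl : heir v = l
        · rw [hhl, Function.update_self, hd]
          exact_mod_cast h.death_le v d hd
        · rwa [Function.update_of_ne hhl]
      · by_cases hhl : heir v = l
        · rw [hhl, Function.update_self]
          exact hN v (ne_top_of_lt h₄)
        · rwa [Function.update_of_ne hhl]
  · intro t ht
    refine (h.history t ht).congr fun v => ?_
    by_cases hvl : v = l
    · subst hvl
      rw [Function.update_self, hdl]
      simp [ht]
    · rw [Function.update_of_ne hvl]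

/-- The later state has coarser components. -/
structure Coarsens (T T' : Tracker V) : Prop where
  rep_eq : ∀ x y, T.rep x = T.rep y → T'.rep x = T'.rep y

theorem Coarsens.refl (T : Tracker V) : Coarsens T T := ⟨fun _ _ h => h⟩

theorem Coarsens.trans {T T' T'' : Tracker V} (h : Coarsens T T') (h' : Coarsens T' T'') :
    Coarsens T T'' := ⟨fun x y hxy => h'.rep_eq x y (h.rep_eq x y hxy)⟩

theorem coarsens_kill (i : ℕ) (w l : V) (T : Tracker V) : Coarsens T (T.kill i w l) :=
  ⟨fun _ _ h => by
    classical
    exact congrArg (fun r => if r = l then w else r) h⟩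

/-- The rule `tie` is consulted only at equal births, so the survivor is never younger than the
killed representative. The two representatives are linked through `u` and `v`. -/
theorem merge_spec [Fintype V] {S : List (Step V)} {i : ℕ} {P : V → Prop} {T : Tracker V}
    (h : IsTracking S i P T) (tie : V → V → Bool) {u v : V} (hu : P u) (hv : P v)
    (huv : linkedAt S i u v) :
    IsTracking S i P (T.merge tie i u v) ∧ Coarsens T (T.merge tie i u v) ∧
      (T.merge tie i u v).rep u = (T.merge tie i u v).rep v ∧
      (T.merge tie i u v).star = T.star := by
  classical
  have hT := h
  obtain ⟨death, heir, tick, h'⟩ := hT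
  have hlink : linkedAt S i (T.rep u) (T.rep v) :=
    Setoid.trans' _ (Setoid.symm' _ (h'.linked_rep u hu))
      (Setoid.trans' _ huv (h'.linked_rep v hv))
  unfold Tracker.merge
  split_ifs with h₁ h₂
  · exact ⟨h, .refl T, h₁, rfl⟩
  · refine ⟨isTracking_kill h (h'.rep_mem u hu) (h'.rep_mem v hv) (h'.rep_rep u hu)
      (h'.rep_rep v hv) h₁ (h₂.elim le_of_lt fun h => h.1.le) (Setoid.symm' _ hlink),
      coarsens_kill _ _ _ _, ?_, rfl⟩
    simp [Tracker.kill]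
  · refine ⟨isTracking_kill h (h'.rep_mem v hv) (h'.rep_mem u hu) (h'.rep_rep v hv)
      (h'.rep_rep u hu) (Ne.symm h₁) ?_ hlink, coarsens_kill _ _ _ _, ?_, rfl⟩
    · push Not at h₂
      exact h₂.1
    · simp [Tracker.kill]

theorem foldl_merge_spec [Fintype V] {S : List (Step V)} {i : ℕ} {P : V → Prop}
    (tie : V → V → Bool) (es : List (V × V))
    (hes : ∀ e ∈ es, P e.1 ∧ P e.2 ∧ linkedAt S i e.1 e.2) {T : Tracker V}
    (h : IsTracking S i P T) :
    IsTracking S i P (es.foldl (fun T' e => T'.merge tie i e.1 e.2) T) ∧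
      Coarsens T (es.foldl (fun T' e => T'.merge tie i e.1 e.2) T) ∧
      (∀ e ∈ es, (es.foldl (fun T' e => T'.merge tie i e.1 e.2) T).rep e.1 =
        (es.foldl (fun T' e => T'.merge tie i e.1 e.2) T).rep e.2) ∧
      (es.foldl (fun T' e => T'.merge tie i e.1 e.2) T).star = T.star := by
  induction es generalizing T with
  | nil => exact ⟨h, .refl T, by simp, rfl⟩
  | cons e es ih =>
    obtain ⟨hu, hv, huv⟩ := hes e (by simp)
    obtain ⟨h₁, h₂, h₃, h₄⟩ := merge_spec h tie hu hv huv
    obtain ⟨g₁, g₂, g₃, g₄⟩ := ih (fun e he => hes e (List.mem_cons_of_mem _ he)) h₁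
    refine ⟨g₁, h₂.trans g₂, fun e' he' => ?_, g₄.trans h₄⟩
    rcases List.mem_cons.1 he' with rfl | he'
    · exact g₂.rep_eq _ _ h₃
    · exact g₃ e' he'

/-- The vertices of the contracted part that have been processed are represented by the
representative of the contracted point. -/
structure StarSpec (S : List (Step V)) (i : ℕ) (done : V → Prop) (T : Tracker V) : Prop where
  star_mem : ∀ s, T.star = some s → {s} ∈ contracted S i
  rep_star : ∀ v, done v → ∃ s, T.star = some s ∧ T.rep s = T.rep v

/-- The stored vertex of the contracted point lies in the contracted part, so it is linked to `v`
and merging is legitimate. The first contracted vertex only initiates the point. -/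
theorem contractVertex_spec [Fintype V] {S : List (Step V)} {i : ℕ} {P done : V → Prop}
    {T : Tracker V} (h : IsTracking S i P T) (hs : StarSpec S i done T) (tie : V → V → Bool)
    (hP : ∀ v, {v} ∈ contracted S i → P v) {v : V} (hv : {v} ∈ contracted S i) :
    IsTracking S i P (T.contractVertex tie i v) ∧ Coarsens T (T.contractVertex tie i v) ∧
      StarSpec S i (fun w => w = v ∨ done w) (T.contractVertex tie i v) := by
  unfold Tracker.contractVertex
  split
  · next hstar =>
    refine ⟨?_, ⟨fun _ _ h => h⟩, ?_, ?_⟩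
    · obtain ⟨death, heir, tick, h⟩ := h
      exact ⟨death, heir, tick, ⟨h.1, h.2, h.3, h.4, h.5, h.6, h.7, h.8, h.9, h.10, h.11, h.12⟩⟩
    · rintro s hs
      rwa [← Option.some.inj hs]
    · rintro w (rfl | hw)
      · exact ⟨w, rfl, rfl⟩
      · obtain ⟨s, hs, -⟩ := hs.rep_star w hw
        rw [hstar] at hs
        cases hs
  · next s hstar =>
    have hsA := hs.star_mem s hstar
    obtain ⟨h₁, h₂, h₃, h₄⟩ := merge_spec h tie (hP s hsA) (hP v hv)
      (Relation.EqvGen.rel _ _ (Or.inr ⟨hsA, hv⟩))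
    refine ⟨h₁, h₂, ?_, ?_⟩
    · rw [h₄]
      exact hs.star_mem
    · rw [h₄]
      rintro w (rfl | hw)
      · exact ⟨s, hstar, h₃⟩
      · obtain ⟨s', hs', h⟩ := hs.rep_star w hw
        exact ⟨s', hs', h₂.rep_eq _ _ h⟩

theorem foldl_contractVertex_spec [Fintype V] {S : List (Step V)} {i : ℕ} {P : V → Prop}
    (tie : V → V → Bool) (hP : ∀ v, {v} ∈ contracted S i → P v) (vs : List V)
    (hvs : ∀ v ∈ vs, {v} ∈ contracted S i) {done : V → Prop} {T : Tracker V}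
    (h : IsTracking S i P T) (hs : StarSpec S i done T) :
    IsTracking S i P (vs.foldl (fun T' v => T'.contractVertex tie i v) T) ∧
      Coarsens T (vs.foldl (fun T' v => T'.contractVertex tie i v) T) ∧
      StarSpec S i (fun w => w ∈ vs ∨ done w)
        (vs.foldl (fun T' v => T'.contractVertex tie i v) T) := by
  induction vs generalizing T done with
  | nil => exact ⟨h, .refl T, by simpa using hs⟩
  | cons v vs ih =>
    obtain ⟨h₁, h₂, h₃⟩ := contractVertex_spec h hs tie hP (hvs v (by simp))
    obtain ⟨g₁, g₂, g₃⟩ := ih (fun e he => hvs e (List.mem_cons_of_mem _ he)) h₁ h₃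
    refine ⟨g₁, h₂.trans g₂, g₃.star_mem, fun w hw => g₃.rep_star w ?_⟩
    rcases hw with hw | hw
    · rcases List.mem_cons.1 hw with rfl | hw
      · exact Or.inr (Or.inl rfl)
      · exact Or.inl hw
    · exact Or.inr (Or.inr hw)

end Tracking

/-! ### The tracking invariant along the list of steps -/

section TrackingRun

variable {V : Type u}

/-- The union of everything included before step `i`. -/
def spawnedBefore (S : List (Step V)) (i : ℕ) : SComplex V := ⨆ s ∈ S.take i, s.spawnPart

/-- The union of everything contracted before step `i`. -/
def contractedBefore (S : List (Step V)) (i : ℕ) : SComplex V := ⨆ s ∈ S.take i, s.contractPart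

theorem spawned_eq (S : List (Step V)) (t : ℕ) : spawned S t = spawnedBefore S (t + 1) := rfl

theorem contracted_eq (S : List (Step V)) (t : ℕ) : contracted S t = contractedBefore S (t + 1) :=
  rfl

theorem spawnedBefore_mono (S : List (Step V)) : Monotone (spawnedBefore S) := fun _ _ h =>
  biSup_mono fun _ hs => List.take_subset_take_left S h hs

theorem spawnedBefore_zero (S : List (Step V)) : spawnedBefore S 0 = ⊥ := by
  simp [spawnedBefore]

theorem contractedBefore_zero (S : List (Step V)) : contractedBefore S 0 = ⊥ := by
  simp [contractedBefore]

theorem spawnedBefore_of_length_le {S : List (Step V)} {i : ℕ} (h : S.length ≤ i) :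
    spawnedBefore S i = spawnedBefore S S.length := by
  rw [spawnedBefore, spawnedBefore, List.take_of_length_le h, List.take_length]

theorem contractedBefore_of_length_le {S : List (Step V)} {i : ℕ} (h : S.length ≤ i) :
    contractedBefore S i = contractedBefore S S.length := by
  rw [contractedBefore, contractedBefore, List.take_of_length_le h, List.take_length]

theorem take_succ_of_drop_eq {α : Type u} {S S' : List α} {s : α} {i : ℕ}
    (h : S.drop i = s :: S') : S.take (i + 1) = S.take i ++ [s] := by
  rw [List.take_add, h]
  rfl

theorem spawned_of_drop_eq {S S' : List (Step V)} {s : Step V} {i : ℕ} (h : S.drop i = s :: S') :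
    spawned S i = spawnedBefore S i ⊔ s.spawnPart := by
  rw [spawned_eq, spawnedBefore, take_succ_of_drop_eq h, spawnedBefore]
  simp [List.mem_append, iSup_or, iSup_sup_eq]

theorem contracted_of_drop_eq {S S' : List (Step V)} {s : Step V} {i : ℕ}
    (h : S.drop i = s :: S') : contracted S i = contractedBefore S i ⊔ s.contractPart := by
  rw [contracted_eq, contractedBefore, take_succ_of_drop_eq h, contractedBefore]
  simp [List.mem_append, iSup_or, iSup_sup_eq]

theorem contractedBefore_le {S : List (Step V)} (hS : ∀ t, contracted S t ≤ spawned S t) (i : ℕ) :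
    contractedBefore S i ≤ spawnedBefore S i := by
  cases i with
  | zero => rw [contractedBefore_zero]; exact bot_le
  | succ i => exact hS i

/-- Constancy of `rep` on the generating pairs suffices. Since every vertex is also linked to its
representative, the fibres of `rep` are then the components. -/
theorem linkedSetoid_le_ker {X A : SComplex V} {T : Tracker V}
    (he : ∀ u v, open scoped Classical in ({u, v} : Finset V) ∈ X → T.rep u = T.rep v)
    (hs : ∀ v, {v} ∈ A → ∃ s, T.star = some s ∧ T.rep s = T.rep v) :
    linkedSetoid X A ≤ Setoid.ker T.rep := by
  refine linkedSetoid_le_iff.2 ⟨he, fun u v hu hv => ?_⟩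
  obtain ⟨s, hs₁, hs₂⟩ := hs u hu
  obtain ⟨s', hs₁', hs₂'⟩ := hs v hv
  obtain rfl : s = s' := Option.some.inj (hs₁.symm.trans hs₁')
  exact hs₂.symm.trans hs₂'

variable [Fintype V]

open scoped Classical in
/-- The state of the tracking procedure before step `i` is correct. -/
structure TrackedBefore (S : List (Step V)) (i : ℕ) (T : Tracker V) : Prop where
  tracks : ∃ death heir tick, Tracks S i (fun v => {v} ∈ spawnedBefore S i) T death heir tick ∧
    ∀ v (d : ℕ), death v = d → d < i
  rep_edge : ∀ u v, ({u, v} : Finset V) ∈ spawnedBefore S i → T.rep u = T.rep v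
  star_mem : ∀ s, T.star = some s → {s} ∈ contractedBefore S i
  rep_star : ∀ v, {v} ∈ contractedBefore S i → ∃ s, T.star = some s ∧ T.rep s = T.rep v

/-- When all finite deaths are at most `t`, being alive at `t` means never having been killed, that
is, being fixed by `rep`. The fixed points of `rep` form a system of representatives for its fibres.
-/
theorem Tracks.aliveRepresent {S : List (Step V)} {i : ℕ} {P : V → Prop} {T : Tracker V}
    {death : V → ℕ∞} {heir : V → V} {tick : V → ℕ∞} (h : Tracks S i P T death heir tick)
    {X A : SComplex V} (hP : ∀ v, P v ↔ {v} ∈ X) (hle : linkedAt S i ≤ linkedSetoid X A)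
    (hker : linkedSetoid X A ≤ Setoid.ker T.rep) {t : ℕ}
    (ht : ∀ v (d : ℕ), death v = d → d ≤ t) : AliveRepresent X A death t where
  exists_linked u hu := by
    have hu' := (hP u).2 hu
    refine ⟨T.rep u, (hP _).1 (h.rep_mem u hu'), ?_, hle (h.linked_rep u hu')⟩
    rw [(h.death_top _ (h.rep_mem u hu')).2 (h.rep_rep u hu')]
    exact ENat.natCast_lt_top t
  eq_of_linked u v hu hv hu' hv' huv := by
    have hrep : ∀ w, {w} ∈ X → (t : ℕ∞) < death w → T.rep w = w := by
      intro w hw hw'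
      refine (h.death_top w ((hP w).2 hw)).1 ?_
      by_contra htop
      obtain ⟨d, hd⟩ := ENat.ne_top_iff_exists.1 htop
      rw [← hd] at hw'
      exact (ht w d hd.symm).not_gt (by exact_mod_cast hw')
    rw [← hrep u hu hu', ← hrep v hv hv']
    exact hker huv

-- At the end of step `i`, edges and contracted vertices have all been processed, so the alive
-- vertices represent the components at time `i`, and this joins the history. A vertex killed in
-- step `i` counts as dead at time `i`. The remaining clauses pass to `i + 1` because linking only
-- becomes coarser.
open scoped Classical in
theorem TrackedBefore.succ {S : List (Step V)} {i : ℕ} {T : Tracker V}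
    (h : IsTracking S i (fun v => {v} ∈ spawned S i) T)
    (he : ∀ u v, ({u, v} : Finset V) ∈ spawned S i → T.rep u = T.rep v)
    (hs : StarSpec S i (fun v => {v} ∈ contracted S i) T) : TrackedBefore S (i + 1) T := by
  obtain ⟨death, heir, tick, h⟩ := h
  refine ⟨⟨death, heir, tick, ?_, fun v d hd => Nat.lt_succ_of_le (h.death_le v d hd)⟩, he,
    hs.star_mem, hs.rep_star⟩
  have hmono := linkedSetoid_mono ((spawned S).monotone i.le_succ)
    ((contracted S).monotone i.le_succ)
  refine ⟨h.rep_mem, h.rep_rep, fun v hv => hmono (h.linked_rep v hv),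
    fun v hv => (h.birth_le v hv).trans i.le_succ, fun v hv t ht => ?_, h.death_top, h.tick_top,
    h.absent, fun v d hd => (h.death_le v d hd).trans i.le_succ, h.dead_eq, h.heir_spec,
    fun t ht => ?_⟩
  · rcases Nat.le_succ_iff.1 ht with ht | rfl
    · exact h.spawned_iff v hv t ht
    · exact iff_of_true ((spawned S).monotone i.le_succ hv) ((h.birth_le v hv).trans i.le_succ)
  · rcases Nat.lt_succ_iff_lt_or_eq.1 ht with ht | rfl
    · exact h.history t ht
    · exact h.aliveRepresent (fun v => Iff.rfl) le_rfl (linkedSetoid_le_ker he hs.rep_star)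
        h.death_le

theorem trackedBefore_init (S : List (Step V)) : TrackedBefore S 0 (Tracker.init V) := by
  classical
  have hX : ∀ s, s ∉ spawnedBefore S 0 := fun s hs => by
    rw [spawnedBefore_zero] at hs
    exact hs
  have hA : ∀ s, s ∉ contractedBefore S 0 := fun s hs => by
    rw [contractedBefore_zero] at hs
    exact hs
  refine ⟨⟨fun _ => ⊤, id, fun _ => ⊤, ?_, ?_⟩, fun u v h => absurd h (hX _), ?_,
    fun v h => absurd h (hA _)⟩
  · constructor
    all_goals try exact fun v h => absurd h (hX _)
    · exact fun v _ => ⟨rfl, rfl⟩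
    · exact fun v d hd => absurd hd.symm (ENat.natCast_ne_top d)
    · simp [Tracker.init]
    · exact fun v d hd => absurd hd.symm (ENat.natCast_ne_top d)
    · exact fun t ht => absurd ht (Nat.not_lt_zero t)
  · exact fun v d hd => absurd hd.symm (ENat.natCast_ne_top d)
  · rintro s hs
    cases hs

theorem TrackedBefore.spawn {S S' : List (Step V)} {i : ℕ} {T : Tracker V} {L : SComplex V}
    (hS : ∀ t, contracted S t ≤ spawned S t) (h : TrackedBefore S i T)
    (hi : S.drop i = .spawn L :: S') (tie : V → V → Bool) {es : List (V × V)}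
    (hes : ∀ e, e ∈ es) :
    TrackedBefore S (i + 1) (T.spawn tie es i (spawnedBefore S i) L) := by
  classical
  have hsp : spawned S i = spawnedBefore S i ⊔ L := spawned_of_drop_eq hi
  have hco : contracted S i = contractedBefore S i := by
    rw [contracted_of_drop_eq hi]
    exact sup_bot_eq _
  obtain ⟨⟨death, heir, tick, ht, -⟩, hedge, hstar, hrs⟩ := h
  -- The state in the middle of the step: the new vertices represent themselves and no new edge has
  -- been processed.
  let T₀ : Tracker V := { T with
    rep := fun v => if ({v} : Finset V) ∈ L ∧ ({v} : Finset V) ∉ spawnedBefore S i then v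
      else T.rep v
    birth := fun v => if ({v} : Finset V) ∈ L ∧ ({v} : Finset V) ∉ spawnedBefore S i then i
      else T.birth v }
  have hrep₀ : ∀ v, {v} ∈ spawnedBefore S i → T₀.rep v = T.rep v := fun v hv =>
    if_neg fun h => h.2 hv
  have hbirth₀ : ∀ v, {v} ∈ spawnedBefore S i → T₀.birth v = T.birth v := fun v hv =>
    if_neg fun h => h.2 hv
  have hnew : ∀ v, {v} ∈ spawned S i → {v} ∉ spawnedBefore S i →
      T₀.rep v = v ∧ T₀.birth v = i := by
    intro v hv hv'
    rw [hsp] at hv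
    have hL : {v} ∈ L := hv.resolve_left hv'
    exact ⟨if_pos ⟨hL, hv'⟩, if_pos ⟨hL, hv'⟩⟩
  have hsub : ∀ s, s ∈ spawnedBefore S i → s ∈ spawned S i := fun s hs => by
    rw [hsp]
    exact Or.inl hs
  have hdead : ∀ v, death v ≠ ⊤ → {v} ∈ spawnedBefore S i := fun v hv => by
    by_contra hv'
    exact hv (ht.absent v hv').1
  have h₀ : Tracks S i (fun v => {v} ∈ spawned S i) T₀ death heir tick := by
    constructor
    · intro v hv
      by_cases hv' : {v} ∈ spawnedBefore S i
      · rw [hrep₀ v hv']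
        exact hsub _ (ht.rep_mem v hv')
      · rwa [(hnew v hv hv').1]
    · intro v hv
      by_cases hv' : {v} ∈ spawnedBefore S i
      · rw [hrep₀ v hv', hrep₀ _ (ht.rep_mem v hv'), ht.rep_rep v hv']
      · rw [(hnew v hv hv').1, (hnew v hv hv').1]
    · intro v hv
      by_cases hv' : {v} ∈ spawnedBefore S i
      · rw [hrep₀ v hv']
        exact ht.linked_rep v hv'
      · rw [(hnew v hv hv').1]
    · intro v hv
      by_cases hv' : {v} ∈ spawnedBefore S i
      · rw [hbirth₀ v hv']
        exact ht.birth_le v hv'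
      · rw [(hnew v hv hv').2]
    · intro v hv t hti
      by_cases hv' : {v} ∈ spawnedBefore S i
      · rw [hbirth₀ v hv']
        exact ht.spawned_iff v hv' t hti
      · rw [(hnew v hv hv').2]
        rcases hti.eq_or_lt with rfl | hti
        · exact iff_of_true hv le_rfl
        -- What is included up to and including time `t` is what is included before step `t + 1`,
        -- and `t + 1 ≤ i`.
        · exact iff_of_false (fun h => hv' (spawnedBefore_mono S hti h)) hti.not_ge
    · intro v hv
      by_cases hv' : {v} ∈ spawnedBefore S i
      · rw [hrep₀ v hv']
        exact ht.death_top v hv'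
      · exact iff_of_true (ht.absent v hv').1 (hnew v hv hv').1
    · intro v hv
      by_cases hv' : {v} ∈ spawnedBefore S i
      · rw [hrep₀ v hv']
        exact ht.tick_top v hv'
      · exact iff_of_true (ht.absent v hv').2 (hnew v hv hv').1
    · exact fun v hv => ht.absent v fun hv' => hv (hsub _ hv')
    · exact ht.death_le
    · have hfilter : (Finset.univ.filter fun v => death v ≠ ⊤ ∧ (T₀.birth v : ℕ∞) < death v) =
          Finset.univ.filter fun v => death v ≠ ⊤ ∧ (T.birth v : ℕ∞) < death v := by
        refine Finset.filter_congr fun v _ => and_congr_right fun hv => ?_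
        rw [hbirth₀ v (hdead v hv)]
      rw [hfilter]
      refine Eq.trans ht.dead_eq (Multiset.map_congr rfl fun v hv => ?_)
      rw [hbirth₀ v (hdead v (Finset.mem_filter.1 hv).2.1)]
    · intro v d hd
      obtain ⟨h₁, h₂, h₃⟩ := ht.heir_spec v d hd
      have hv : {v} ∈ spawnedBefore S i := hdead v (hd ▸ ENat.natCast_ne_top d)
      rw [hbirth₀ v hv, hbirth₀ _ h₁]
      exact ⟨hsub _ h₁, h₂, h₃⟩
    · exact ht.history
  obtain ⟨g₁, g₂, g₃, g₄⟩ := foldl_merge_spec tie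
    (es.filter fun e => decide (({e.1, e.2} : Finset V) ∈ L ∧
      ({e.1, e.2} : Finset V) ∉ spawnedBefore S i))
    (fun e he => by
      have heL : ({e.1, e.2} : Finset V) ∈ L := (of_decide_eq_true (List.mem_filter.1 he).2).1
      have heS : ({e.1, e.2} : Finset V) ∈ spawned S i := by
        rw [hsp]
        exact Or.inr heL
      exact ⟨mem_of_subset heS (by simp) (by simp), mem_of_subset heS (by simp) (by simp),
        Relation.EqvGen.rel _ _ (Or.inl heS)⟩) ⟨death, heir, tick, h₀⟩
  have hs₀ : ∀ x y, {x} ∈ spawnedBefore S i → {y} ∈ spawnedBefore S i → T.rep x = T.rep y →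
      T₀.rep x = T₀.rep y := fun x y hx hy hxy => by rw [hrep₀ x hx, hrep₀ y hy, hxy]
  refine TrackedBefore.succ g₁ (fun u v huv => ?_) ⟨fun s hs => ?_, fun v hv => ?_⟩
  -- The endpoints of an old edge already shared a representative, and merging never separates
  -- vertices. A new edge is met in the run because `es` lists all pairs.
  · by_cases huv' : ({u, v} : Finset V) ∈ spawnedBefore S i
    · exact g₂.rep_eq u v (hs₀ u v (mem_of_subset huv' (by simp) (by simp))
        (mem_of_subset huv' (by simp) (by simp)) (hedge u v huv'))
    · rw [hsp] at huv
      exact g₃ (u, v) (List.mem_filter.2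
        ⟨hes _, decide_eq_true ⟨huv.resolve_left huv', huv'⟩⟩)
  · rw [hco]
    exact hstar s (g₄.symm.trans hs)
  · rw [hco] at hv
    obtain ⟨s, hs, hsv⟩ := hrs v hv
    exact ⟨s, g₄.trans hs, g₂.rep_eq _ _ (hs₀ s v (contractedBefore_le hS i (hstar s hs))
      (contractedBefore_le hS i hv) hsv)⟩

theorem TrackedBefore.contract {S S' : List (Step V)} {i : ℕ} {T : Tracker V} {L : SComplex V}
    (hS : ∀ t, contracted S t ≤ spawned S t) (h : TrackedBefore S i T)
    (hi : S.drop i = .contract L :: S') (tie : V → V → Bool) {vs : List V} (hvs : ∀ v, v ∈ vs) :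
    TrackedBefore S (i + 1) (T.contract tie vs i L) := by
  classical
  have hsp : spawned S i = spawnedBefore S i := by
    rw [spawned_of_drop_eq hi]
    exact sup_bot_eq _
  have hco : contracted S i = contractedBefore S i ⊔ L := contracted_of_drop_eq hi
  obtain ⟨⟨death, heir, tick, ht, -⟩, hedge, hstar, hrs⟩ := h
  rw [← hsp] at ht hedge
  -- Vertices contracted in earlier steps count as done from the start, so only those of `L` need
  -- processing.
  obtain ⟨g₁, g₂, g₃⟩ := foldl_contractVertex_spec (done := fun v => {v} ∈ contractedBefore S i)
    tie (fun v hv => hS i hv) (vs.filter fun v => decide (({v} : Finset V) ∈ L))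
    (fun v hv => by
      rw [hco]
      exact Or.inr (of_decide_eq_true (List.mem_filter.1 hv).2)) ⟨death, heir, tick, ht⟩
    ⟨fun s hs => by
      rw [hco]
      exact Or.inl (hstar s hs), hrs⟩
  refine TrackedBefore.succ g₁ (fun u v huv => g₂.rep_eq _ _ (hedge u v huv))
    ⟨g₃.star_mem, fun v hv => g₃.rep_star v ?_⟩
  rw [hco] at hv
  rcases hv with hv | hv
  · exact Or.inr hv
  · exact Or.inl (List.mem_filter.2 ⟨hvs v, decide_eq_true hv⟩)

theorem TrackedBefore.run {S : List (Step V)} (hS : ∀ t, contracted S t ≤ spawned S t)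
    (tie : V → V → Bool) {vs : List V} {es : List (V × V)} (hvs : ∀ v, v ∈ vs)
    (hes : ∀ e, e ∈ es) (S' : List (Step V)) {i : ℕ} (hi : S.drop i = S') {T : Tracker V}
    (h : TrackedBefore S i T) :
    TrackedBefore S (i + S'.length) (Tracker.run tie vs es i (spawnedBefore S i) S' T) := by
  induction S' generalizing i T with
  | nil => exact h
  | cons s S' ih =>
    have hdrop : S.drop (i + 1) = S' := by
      rw [← List.drop_drop, hi]
      rfl
    have hlen : i + (s :: S').length = i + 1 + S'.length := by
      rw [List.length_cons]
      ring
    rw [hlen]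
    cases s with
    | spawn L =>
      have := ih hdrop (h.spawn hS hi tie hes)
      rw [← spawned_eq, spawned_of_drop_eq hi] at this
      exact this
    | contract L =>
      have := ih hdrop (h.contract hS hi tie hvs)
      rw [← spawned_eq, spawned_of_drop_eq hi] at this
      rwa [show spawnedBefore S i ⊔ (Step.contract L).spawnPart = spawnedBefore S i from
        sup_bot_eq _] at this

end TrackingRun

/-- The tracking procedure computes the persistence diagram in degree zero. -/
theorem isPersistenceDiagram_trackedPairs {V : Type u} [Finite V] {S : List (Step V)}
    (hS : ∀ t, contracted S t ≤ spawned S t) (tie : V → V → Bool) {vs : List V}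
    {es : List (V × V)} (hvs : ∀ v, v ∈ vs) (hes : ∀ e, e ∈ es) :
    IsPersistenceDiagram (persistentHomology 0 (quotientSequence S))
      (trackedPairs tie vs es S) := by
  classical
  have := Fintype.ofFinite V
  obtain ⟨T, hT⟩ : ∃ T, T = Tracker.run tie vs es 0 ⊥ S (Tracker.init V) := ⟨_, rfl⟩
  have h : TrackedBefore S S.length T := by
    have := (trackedBefore_init S).run hS tie hvs hes S rfl
    rwa [zero_add, spawnedBefore_zero, ← hT] at this
  obtain ⟨⟨death, heir, tick, ht, hlt⟩, hedge, hstar, hrs⟩ := h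
  have hsp : ∀ t, S.length ≤ t + 1 → spawned S t = spawnedBefore S S.length := fun t =>
    spawnedBefore_of_length_le
  have hco : ∀ t, S.length ≤ t + 1 → contracted S t = contractedBefore S S.length := fun t =>
    contractedBefore_of_length_le
  have hP : ∀ t v, {v} ∈ spawned S t ↔ {v} ∈ spawnedBefore S S.length ∧ T.birth v ≤ t := by
    intro t v
    rcases le_total t S.length with h | h
    · constructor
      · intro hv
        have hv' : {v} ∈ spawnedBefore S S.length := by
          rw [← hsp S.length (Nat.le_succ _)]
          exact (spawned S).monotone h hv
        exact ⟨hv', (ht.spawned_iff v hv' t h).1 hv⟩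
      · rintro ⟨hv', hb⟩
        exact (ht.spawned_iff v hv' t h).2 hb
    · rw [hsp t (h.trans t.le_succ)]
      exact ⟨fun hv => ⟨hv, (ht.birth_le v hv).trans h⟩, fun hv => hv.1⟩
  -- Times before the end are covered by the recorded history. From the end on, the complexes are
  -- constant and the final state applies.
  have halive : ∀ t, AliveRepresent (spawned S t) (contracted S t) death t := by
    intro t
    rcases lt_or_ge t S.length with h | h
    · exact ht.history t h
    · have h₁ := hsp t (h.trans t.le_succ)
      have h₂ := hco t (h.trans t.le_succ)
      refine ht.aliveRepresent (fun v => by rw [h₁])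
        (linkedSetoid_mono ((spawned S).monotone h) ((contracted S).monotone h)) ?_
        fun v d hd => (hlt v d hd).le.trans h
      rw [h₁, h₂]
      exact linkedSetoid_le_ker hedge hrs
  have key := isPersistenceDiagram_of_elder_rule hS hP halive
    fun v d _ hd => ht.heir_spec v d hd
  have hset : (Set.toFinite {v : V | {v} ∈ spawned S S.length ∧ T.rep v = v}).toFinset =
      Finset.univ.filter fun v => {v} ∈ spawnedBefore S S.length ∧ death v = ⊤ := by
    ext v
    rw [Set.Finite.mem_toFinset, Finset.mem_filter, hsp S.length (Nat.le_succ _)]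
    constructor
    · rintro ⟨h₁, h₂⟩
      exact ⟨Finset.mem_univ v, h₁, (ht.death_top v h₁).2 h₂⟩
    · rintro ⟨-, h₁, h₂⟩
      exact ⟨h₁, (ht.death_top v h₁).1 h₂⟩
  -- The elder rule gives one pair for each vertex with birth before death. These are the
  -- non-trivial recorded deaths together with the survivors, which have death ⊤.
  have hsplit : (Finset.univ.filter fun v =>
      {v} ∈ spawnedBefore S S.length ∧ (T.birth v : ℕ∞) < death v) =
      (Finset.univ.filter fun v => death v ≠ ⊤ ∧ (T.birth v : ℕ∞) < death v).disjUnion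
        (Finset.univ.filter fun v => {v} ∈ spawnedBefore S S.length ∧ death v = ⊤)
        (Finset.disjoint_filter.2 fun v _ h₁ h₂ => h₁.1 h₂.2) := by
    ext v
    simp only [Finset.mem_disjUnion, Finset.mem_filter, Finset.mem_univ, true_and]
    by_cases htop : death v = ⊤
    · simp [htop]
    · have hv : {v} ∈ spawnedBefore S S.length := by
        by_contra hv
        exact htop (ht.absent v hv).1
      simp [htop, hv]
  have hmap : (Finset.univ.filter fun v =>
      {v} ∈ spawnedBefore S S.length ∧ death v = ⊤).val.map (fun v => (T.birth v, (⊤ : ℕ∞))) =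
      (Finset.univ.filter fun v =>
        {v} ∈ spawnedBefore S S.length ∧ death v = ⊤).val.map (fun v => (T.birth v, death v)) :=
    Multiset.map_congr rfl fun v hv => by rw [(Finset.mem_filter.1 hv).2.2]
  rw [hsplit, Finset.disjUnion_val, Multiset.map_add, ← ht.dead_eq, ← hmap, ← hset, hT] at key
  exact key

/-! ### Only included simplices are contracted -/

section Valid

variable {V : Type u}

/-- Only `C` contracts anything, and once a step of `C` has been taken, all of `B`, and hence all of
`K`, has been included. -/
theorem contracted_le_spawned_of_append {K : SComplex V} {B C : List (Step V)}
    (hB : ∀ s ∈ B, s.contractPart = ⊥) (hC : ∀ s ∈ C, s.contractPart ≤ K)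
    (hK : K ≤ ⨆ s ∈ B, s.spawnPart) (t : ℕ) : contracted (B ++ C) t ≤ spawned (B ++ C) t := by
  refine iSup₂_le fun s hs => ?_
  rw [List.take_append, List.mem_append] at hs
  rcases hs with hs | hs
  · rw [hB s (List.mem_of_mem_take hs)]
    exact bot_le
  · have hlen : B.length ≤ t + 1 := by
      by_contra h
      rw [Nat.sub_eq_zero_of_le (by lia)] at hs
      simp at hs
    refine (hC s (List.mem_of_mem_take hs)).trans (hK.trans ?_)
    refine biSup_mono fun r hr => ?_
    rw [List.take_append, List.take_of_length_le hlen]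
    exact List.mem_append_left _ hr

theorem contracted_le_spawned_of_spawn_cons {K : SComplex V} {C : List (Step V)}
    (hC : ∀ s ∈ C, s.contractPart ≤ K) (t : ℕ) :
    contracted (Step.spawn K :: C) t ≤ spawned (Step.spawn K :: C) t :=
  contracted_le_spawned_of_append (B := [Step.spawn K]) (K := K)
    (by
      intro s hs
      rw [List.mem_singleton.1 hs]
      rfl) hC
    (le_iSup₂_of_le (f := fun s (_ : s ∈ [Step.spawn K]) => s.spawnPart) (Step.spawn K)
      (List.mem_singleton_self _) le_rfl) t

variable [Finite V]

theorem exists_level_eq {K : SComplex V} (f : Finset V → ℝ) {s : Finset V} (hs : s ∈ K) :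
    ∃ i, level K f i = f s := by
  have h : f s ∈ levels K f := by
    rw [levels, Set.Finite.mem_toFinset]
    exact ⟨s, hs, rfl⟩
  have hr := Finset.range_orderEmbOfFin (levels K f) rfl
  have : f s ∈ Set.range ((levels K f).orderEmbOfFin rfl) := by
    rw [hr]
    exact h
  exact this

theorem exists_eq_level {K : SComplex V} (f : Finset V → ℝ) (i : Fin (numLevels K f)) :
    ∃ s ∈ K, f s = level K f i := by
  have h : level K f i ∈ levels K f := Finset.orderEmbOfFin_mem _ _ i
  rw [levels, Set.Finite.mem_toFinset] at h
  exact h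

theorem intermediate_le (K : SComplex V) (f : Finset V → ℝ) (i : Fin (numLevels K f)) :
    intermediate K f i ≤ K := by
  rintro t ⟨ht, s, hs, -, hts⟩
  exact mem_of_subset hs hts ht

theorem mem_intermediate {K : SComplex V} {f : Finset V → ℝ} {i : Fin (numLevels K f)}
    {s : Finset V} (hs : s ∈ K) (h : level K f i = f s) : s ∈ intermediate K f i :=
  ⟨nonempty_of_mem hs, s, hs, h.symm, subset_rfl⟩

theorem mem_sublevel {K : SComplex V} {f : Finset V → ℝ} (hf : IsFiltrationFunction K f)
    {i : Fin (numLevels K f)} {s : Finset V} (hs : s ∈ K) (h : level K f i = f s) :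
    s ∈ sublevel K f hf i :=
  ⟨hs, h.ge⟩

theorem le_iSup_filtrationSteps {K : SComplex V} {f : Finset V → ℝ}
    (hf : IsFiltrationFunction K f) : K ≤ ⨆ s ∈ filtrationSteps K f hf, s.spawnPart := by
  intro s hs
  obtain ⟨i, hi⟩ := exists_level_eq f hs
  have hmem : Step.spawn (sublevel K f hf i) ∈ filtrationSteps K f hf :=
    List.mem_ofFn.2 ⟨i, rfl⟩
  exact le_iSup₂_of_le (f := fun s (_ : s ∈ filtrationSteps K f hf) => s.spawnPart) _ hmem le_rfl
    (mem_sublevel hf hs hi)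

theorem le_iSup_spawnSteps (K : SComplex V) (f : Finset V → ℝ)
    (σ : Equiv.Perm (Fin (numLevels K f))) : K ≤ ⨆ s ∈ spawnSteps K f σ, s.spawnPart := by
  intro s hs
  obtain ⟨i, hi⟩ := exists_level_eq f hs
  have hmem : Step.spawn (intermediate K f i) ∈ spawnSteps K f σ :=
    List.mem_ofFn.2 ⟨σ.symm i, by simp⟩
  exact le_iSup₂_of_le (f := fun s (_ : s ∈ spawnSteps K f σ) => s.spawnPart) _ hmem le_rfl
    (mem_intermediate hs hi)

theorem contractPart_filtrationSteps {K : SComplex V} {f : Finset V → ℝ}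
    (hf : IsFiltrationFunction K f) : ∀ s ∈ filtrationSteps K f hf, s.contractPart = ⊥ := by
  intro s hs
  obtain ⟨i, rfl⟩ := List.mem_ofFn.1 hs
  rfl

theorem contractPart_spawnSteps (K : SComplex V) (f : Finset V → ℝ)
    (σ : Equiv.Perm (Fin (numLevels K f))) : ∀ s ∈ spawnSteps K f σ, s.contractPart = ⊥ := by
  intro s hs
  obtain ⟨i, rfl⟩ := List.mem_ofFn.1 hs
  rfl

theorem contractPart_contractSteps (K : SComplex V) (f : Finset V → ℝ)
    (τ : Equiv.Perm (Fin (numLevels K f))) : ∀ s ∈ contractSteps K f τ, s.contractPart ≤ K := by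
  intro s hs
  obtain ⟨i, rfl⟩ := List.mem_ofFn.1 hs
  exact intermediate_le K f _

theorem contracted_le_spawned_of_isHourglass {K : SComplex V} {f : Finset V → ℝ}
    {S : List (Step V)} (h : IsHourglass K f S) (t : ℕ) : contracted S t ≤ spawned S t := by
  obtain ⟨moves, rfl, hmoves⟩ := h
  refine iSup₂_le fun s hs => ?_
  rw [← List.map_take] at hs
  obtain ⟨⟨b, I⟩, hm, rfl⟩ := List.mem_map.1 hs
  cases b with
  | true => exact bot_le
  | false =>
    refine iSup₂_le fun i hi => ?_
    obtain ⟨q, hq⟩ := List.getElem?_of_mem hm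
    have hqt : q < t + 1 :=
      (List.getElem?_eq_some_iff.1 hq).1.trans_le (List.length_take_le _ _)
    rw [List.getElem?_take_of_lt hqt] at hq
    -- The move that includes this complex comes before `q`, hence is also among the first `t + 1`
    -- moves.
    obtain ⟨p, hp, J, hJ, hiJ⟩ := hmoves q I hq i hi
    rw [← List.getElem?_take_of_lt (hp.trans hqt)] at hJ
    have hmem := List.mem_map_of_mem (f := fun p : Bool × Finset (Fin (numLevels K f)) =>
      if p.1 then Step.spawn (⨆ i ∈ p.2, intermediate K f i)
      else Step.contract (⨆ i ∈ p.2, intermediate K f i)) (List.mem_of_getElem? hJ)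
    rw [List.map_take] at hmem
    exact (le_iSup₂_of_le (f := fun i (_ : i ∈ J) => intermediate K f i) i hiJ le_rfl).trans
      (le_iSup₂ (f := fun s (_ : s ∈ List.take (t + 1) (moves.map _)) => Step.spawnPart s) _ hmem)

/-- In all constructions, only simplices that are present are contracted. -/
theorem Method.IsSequence.contracted_le_spawned {m : Method} {K : SComplex V}
    {S : List (Step V)} (h : m.IsSequence K S) (t : ℕ) : contracted S t ≤ spawned S t := by
  cases m with
  | forward =>
    obtain ⟨f, hf, rfl⟩ := h
    have := contracted_le_spawned_of_append (contractPart_filtrationSteps hf) (C := [])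
      (by simp) (le_iSup_filtrationSteps hf) t
    rwa [List.append_nil] at this
  | contraction =>
    obtain ⟨Ls, hL, rfl, -⟩ := h
    refine contracted_le_spawned_of_spawn_cons (fun s hs => ?_) t
    obtain ⟨L, hLs, rfl⟩ := List.mem_map.1 hs
    exact hL L hLs
  | backward =>
    obtain ⟨f, -, rfl⟩ := h
    exact contracted_le_spawned_of_spawn_cons (contractPart_contractSteps K f _) t
  | forwardBackward =>
    obtain ⟨f, hf, rfl⟩ := h
    exact contracted_le_spawned_of_append (contractPart_filtrationSteps hf)
      (contractPart_contractSteps K f _) (le_iSup_filtrationSteps hf) t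
  | permutationForwardBackward =>
    obtain ⟨f, σ, τ, -, rfl⟩ := h
    exact contracted_le_spawned_of_append (contractPart_spawnSteps K f σ)
      (contractPart_contractSteps K f τ) (le_iSup_spawnSteps K f σ) t
  | twoFunctionForwardBackward =>
    obtain ⟨f, g, hf, -, rfl⟩ := h
    exact contracted_le_spawned_of_append (contractPart_filtrationSteps hf)
      (contractPart_contractSteps K g _) (le_iSup_filtrationSteps hf) t
  | hourglass =>
    obtain ⟨f, -, h⟩ := h
    exact contracted_le_spawned_of_isHourglass h t

end Valid

/-! ### The disjoint vertex shows up in degree zero -/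

/-- A persistence diagram determines the dimensions. -/
theorem IsPersistenceDiagram.finrank_eq {M : ℕ ⥤ ModuleCat.{u} (ZMod 2)}
    {D : Multiset (ℕ × ℕ∞)} (h : IsPersistenceDiagram M D) (t : ℕ) :
    Module.finrank (ZMod 2) (M.obj t) =
      (D.filter fun p => p.1 ≤ t ∧ (t : ℕ∞) < p.2).card := by
  classical
  obtain ⟨n, b, d, e, -, rfl, hbasis, -⟩ := h
  rw [Module.finrank_eq_card_basis (Module.Basis.mk (hbasis t).1 (hbasis t).2.ge),
    Multiset.filter_map, Multiset.card_map, Fintype.card_subtype]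
  rfl

theorem joined_of_finrank_eq_one {Y : TopCat.{u}}
    (h : Module.finrank (ZMod 2) ((homologyMod2 0).obj Y) = 1) (x y : Y) : Joined x y := by
  obtain ⟨b, -⟩ := exists_basis_pointClass Y
  rw [Module.finrank_eq_nat_card_basis b, Nat.card_eq_one_iff_unique] at h
  have := h.1
  exact Quotient.exact (Subsingleton.elim (ZerothHomotopy.mk x) (ZerothHomotopy.mk y))

theorem finrank_homologyMod2_zero_of_pathConnected (Y : TopCat.{u}) [PathConnectedSpace Y] :
    Module.finrank (ZMod 2) ((homologyMod2 0).obj Y) = 1 := by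
  obtain ⟨b, -⟩ := exists_basis_pointClass Y
  rw [Module.finrank_eq_nat_card_basis b, Nat.card_eq_one_iff_unique]
  exact ⟨inferInstance, inferInstance⟩

/-- If the construction starts with the inclusion of a connected complex, then the simplicial
quotient method fails in degree zero. -/
theorem not_isPersistenceDiagram_coneSequence {V : Type u} [Finite V] {S S' : List (Step V)}
    {L : SComplex V} (hS : S = .spawn L :: S') [PathConnectedSpace (realization L)]
    {D : Multiset (ℕ × ℕ∞)}
    (hD : IsPersistenceDiagram (persistentHomology 0 (quotientSequence S)) D) :
    ¬ IsPersistenceDiagram (persistentHomology 0 (coneSequence S)) D := by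
  intro hD'
  have hsp : spawned S 0 = L := by
    rw [spawned_of_drop_eq (i := 0) (s := .spawn L) (S' := S') hS, spawnedBefore_zero]
    exact bot_sup_eq _
  have hco : contracted S 0 = ⊥ := by
    rw [contracted_of_drop_eq (i := 0) (s := .spawn L) (S' := S') hS, contractedBefore_zero]
    exact bot_sup_eq _
  have hA : ∀ s, s ∉ contracted S 0 := fun s hs => by
    rw [hco] at hs
    exact hs
  have : PathConnectedSpace ((quotientSequence S).obj 0) := by
    have : PathConnectedSpace (realization (spawned S 0)) := by rwa [hsp]
    exact inferInstanceAs (PathConnectedSpace (Quotient _))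
  -- A common diagram would force equal dimensions at time 0, namely 1 by connectedness. Then a path
  -- would join the apex to the base, although the points with non-zero apex coordinate form an open
  -- and closed set.
  have h₁ := (hD'.finrank_eq 0).trans (hD.finrank_eq 0).symm
  have h₂ := h₁.trans (finrank_homologyMod2_zero_of_pathConnected ((quotientSequence S).obj 0))
  obtain ⟨x⟩ : Nonempty (realization (spawned S 0)) := by
    rw [hsp]
    infer_instance
  obtain ⟨p, hp, -⟩ := exists_apex (spawned S 0) (contracted S 0)
  have hj : Joined p (baseInclusion (spawned S 0) (contracted S 0) x) :=
    joined_of_finrank_eq_one (Y := (coneSequence S).obj 0) h₂ _ _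
  exact (isClopen_none_ne_zero (X := spawned S 0) hA).connectedComponent_subset hp
    (pathComponent_subset_component p hj) rfl

theorem exists_ofFn_eq_cons {α : Type u} {n : ℕ} (hn : 0 < n) (g : Fin n → α) :
    ∃ l, List.ofFn g = g ⟨0, hn⟩ :: l := by
  cases n with
  | zero => exact absurd hn (lt_irrefl 0)
  | succ n => exact ⟨_, List.ofFn_succ⟩

/-- On a single vertex, each construction has a sequence that starts with the inclusion of it. -/
theorem exists_isSequence_point (m : Method) : ∃ (S S' : List (Step PUnit.{u + 1}))
    (L : SComplex PUnit.{u + 1}), m.IsSequence ⊤ S ∧ S = .spawn L :: S' ∧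
      PathConnectedSpace (realization L) := by
  let K : SComplex PUnit.{u + 1} := ⊤
  let f : Finset PUnit.{u + 1} → ℝ := fun _ => 0
  have hf : IsFiltrationFunction K f := fun _ _ _ _ _ => le_rfl
  have hone : ∀ s : Finset PUnit.{u + 1}, s.Nonempty → s = {PUnit.unit} := by
    intro s hs
    obtain ⟨x, hx⟩ := hs
    ext y
    simpa [Subsingleton.elim y x] using hx
  have hpc : ∀ L : SComplex PUnit.{u + 1}, (∃ s, s ∈ L) → PathConnectedSpace (realization L) := by
    rintro L ⟨s, hs⟩
    have hs' : {PUnit.unit} ∈ L := hone s (nonempty_of_mem hs) ▸ hs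
    have hsub : Subsingleton (realization L) := ⟨fun x y => by
      have h := fun x : realization L => (mem_realization_iff.1 x.2).2.1
      simp only [Finset.univ_unique, Finset.sum_singleton] at h
      ext v
      exact (h x).trans (h y).symm⟩
    exact ⟨⟨vertexPoint hs'⟩, fun x y => by
      rw [Subsingleton.elim x y]⟩
  have hKne : ({PUnit.unit} : Finset PUnit.{u + 1}) ∈ K := Finset.singleton_nonempty _
  have hn : 0 < numLevels K f := by
    obtain ⟨i, -⟩ := exists_level_eq f hKne
    exact i.pos
  have hsub : ∃ s, s ∈ sublevel K f hf ⟨0, hn⟩ := by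
    obtain ⟨s, hs, h⟩ := exists_eq_level f ⟨0, hn⟩
    exact ⟨s, mem_sublevel hf hs h.symm⟩
  have hint : ∃ s, s ∈ intermediate K f ⟨0, hn⟩ := by
    obtain ⟨s, hs, h⟩ := exists_eq_level f ⟨0, hn⟩
    exact ⟨s, mem_intermediate hs h.symm⟩
  obtain ⟨l, hl⟩ := exists_ofFn_eq_cons hn fun i => Step.spawn (sublevel K f hf i)
  cases m with
  | forward => exact ⟨_, l, _, ⟨f, hf, rfl⟩, hl, hpc _ hsub⟩
  | contraction =>
    -- No contraction is needed: the realization of the one-vertex complex is already a point.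
    refine ⟨[.spawn K], [], K, ⟨[], by simp, rfl, ?_⟩, rfl, hpc K ⟨_, hKne⟩⟩
    have hsp : spawned [Step.spawn K] 0 = K := by
      rw [spawned_of_drop_eq (i := 0) (s := .spawn K) (S' := []) rfl, spawnedBefore_zero]
      exact bot_sup_eq _
    have hsubs : Subsingleton (realization (spawned [Step.spawn K] 0)) := ⟨fun x y => by
      have h := fun x : realization (spawned [Step.spawn K] 0) => (mem_realization_iff.1 x.2).2.1
      simp only [Finset.univ_unique, Finset.sum_singleton] at h
      ext v
      exact (h x).trans (h y).symm⟩
    have hmem : {PUnit.unit} ∈ spawned [Step.spawn K] 0 := by rw [hsp]; exact hKne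
    exact ⟨⟨⟨contractProj _ (contracted [Step.spawn K] 0) (vertexPoint hmem)⟩, fun y => by
      induction y using Quotient.inductionOn with | _ x
      exact congrArg (contractProj _ _) (Subsingleton.elim _ _)⟩⟩
  | backward => exact ⟨_, _, K, ⟨f, hf, rfl⟩, rfl, hpc K ⟨_, hKne⟩⟩
  | forwardBackward =>
    exact ⟨_, l ++ _, _, ⟨f, hf, rfl⟩, by rw [filtrationSteps, hl]; rfl, hpc _ hsub⟩
  | permutationForwardBackward =>
    obtain ⟨l', hl'⟩ := exists_ofFn_eq_cons hn fun i => Step.spawn (intermediate K f i)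
    refine ⟨_, l' ++ contractSteps K f (Equiv.refl _), _,
      ⟨f, Equiv.refl _, Equiv.refl _, hf, rfl⟩, ?_, hpc _ hint⟩
    change List.ofFn (fun i => Step.spawn (intermediate K f i)) ++ _ = _
    rw [hl']
    rfl
  | twoFunctionForwardBackward =>
    exact ⟨_, l ++ _, _, ⟨f, f, hf, hf, rfl⟩, by rw [filtrationSteps, hl]; rfl, hpc _ hsub⟩
  | hourglass =>
    refine ⟨_, [], _, ⟨f, hf, [(true, {⟨0, hn⟩})], rfl, ?_⟩, rfl, ?_⟩
    · intro q I hq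
      rcases q with - | q <;> simp at hq
    · obtain ⟨s, hs⟩ := hint
      exact hpc _ ⟨s, le_iSup₂ (f := fun i (_ : i ∈ ({⟨0, hn⟩} : Finset (Fin (numLevels K f)))) =>
        intermediate K f i) ⟨0, hn⟩ (Finset.mem_singleton_self _) hs⟩

end ContractionPersistence

open ContractionPersistence
theorem mainTheorem7 (m : Method) :
    (∀ (V : Type u) [Finite V] (K : SComplex V) (S : List (Step V)), m.IsSequence K S →
      -- in positive degrees, the simplicial quotient method gives the same diagrams
      (∀ k : ℕ, 0 < k → ∀ D : Multiset (ℕ × ℕ∞),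
        IsPersistenceDiagram (persistentHomology k (coneSequence S)) D ↔
          IsPersistenceDiagram (persistentHomology k (quotientSequence S)) D) ∧
      -- in degree zero, the diagram is found by tracking one representative per component
      (∀ (tie : V → V → Bool) (vs : List V) (es : List (V × V)),
        (∀ v, v ∈ vs) → (∀ e, e ∈ es) →
        IsPersistenceDiagram (persistentHomology 0 (quotientSequence S))
          (trackedPairs tie vs es S))) ∧
    -- in degree zero, the simplicial quotient method can give a different diagram
    (∃ (V : Type u) (_ : Finite V) (K : SComplex V) (S : List (Step V)), m.IsSequence K S ∧
      ∃ D : Multiset (ℕ × ℕ∞),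
        IsPersistenceDiagram (persistentHomology 0 (quotientSequence S)) D ∧
          ¬ IsPersistenceDiagram (persistentHomology 0 (coneSequence S)) D) := by
  refine ⟨fun V _ K S h => ⟨fun k hk D => ?_, fun tie vs es hvs hes => ?_⟩, ?_⟩
  · exact isPersistenceDiagram_coneSequence_iff h.contracted_le_spawned hk.ne' D
  · exact isPersistenceDiagram_trackedPairs h.contracted_le_spawned tie hvs hes
  · obtain ⟨S, S', L, hS, hSL, hL⟩ := exists_isSequence_point.{u} m
    -- The tracker, with an arbitrary tie rule, supplies a diagram of the quotient sequence; its
    -- actual value does not matter.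
    have hD := isPersistenceDiagram_trackedPairs hS.contracted_le_spawned (fun _ _ => true)
      (vs := [PUnit.unit]) (es := [(PUnit.unit, PUnit.unit)]) (by simp) (by simp)
    exact ⟨PUnit, inferInstance, ⊤, S, hS, _, hD, not_isPersistenceDiagram_coneSequence hSL hD⟩
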